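/- Let $\Bbbk$ be any field and $m\ge 1$. Write $[m]=\{1,\dots,m\}$, let $R=\Bbbk[t_1,\dots,t_m]$ with its $\mathbb N^m$-grading $|t_i|=\vec e_i$, and for $\sigma\subseteq[m]$ let $R_\sigma=R[t_i^{-1}\mid i\in\sigma]$, which is graded by $\sigma^{-1}\mathbb N^m=\{d\in\mathbb Z^m\mid d_i\ge 0 \text{ for } i\notin\sigma\}$. All modules are graded ($R_\sigma$-modules by $\sigma^{-1}\mathbb N^m$) and all maps preserve degrees. Let $K_m=\{\sigma\subseteq[m]\mid \#\sigma\le m-2\}$. An object $M$ of the category $\mathcal D(K_m)$ consists of a finitely generated $R_\sigma$-module $M_\sigma$ for each $\sigma\subseteq [m]$ with $\sigma\notin K_m$, and $R_\sigma$-linear maps $\varphi_{\sigma,\tau}\colon M_\sigma\to M_\tau$ for $\sigma\subseteq\tau$ which are functorial ($\varphi_{\sigma,\sigma}=\mathrm{id}$, $\varphi_{\tau,\upsilon}\varphi_{\sigma,\tau}=\varphi_{\sigma,\upsilon}$) and induce isomorphisms $R_\tau\otimes_{R_\sigma}M_\sigma\cong M_\tau$; morphisms are families of $R_\sigma$-linear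 maps compatible with the $\varphi_{\sigma,\tau}$. For a finitely generated $R$-module $N$, let $L_{K_m}(N)$ be the object with $L_{K_m}(N)_\sigma=R_\sigma\otimes_R N$. Put $\sigma_i=[m]\setminus\{i\}$. An object $M$ is torsion-free if, for every $i$, no nonzero element of $M_{\sigma_i}$ is annihilated by a power of $t_i$. The rank of $M$ is the dimension over $\Bbbk$ of the part of $M_{[m]}$ in multidegree $\vec 0$. For $\vec a\in\mathbb N^m$, the quadrant $[\vec a,\infty)$ is the object with $[\vec a,\infty)_\sigma=t^{\vec a}R_\sigma$ and the inclusions as transition maps. (1) Let $m\ge 3$, and let $$\overline M=R\langle w,y,z\mid t_1w=t_3y-t_2z\rangle,\qquad |w|=\vec e_2+\vec e_3,\quad |y|=\vec e_1+\vec e_2,\quad |z|=\vec e_1+\vec e_3.$$ Then the object $L_{K_m}(\overline M)$ of $\mathcal D(K_m)$ is torsion-free, has rank $2$, and is indecomposable. Consequently it is a torsion-free object which is not isomorphic to a finite direct sum of quadrants $[\vec a,\infty)$. (2) In contrast, for $m=2$ every torsion-free object of $\mathcal D(K_2)$ is isomorphic to a finite direct sum of quadrants. -/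

import Mathlib

open CategoryTheory CategoryTheory.Limits

universe u

namespace PersLoc

noncomputable section

/-! ### Graded modules over the localized polynomial rings -/

/-- The monoid `σ⁻¹ℕ^m`: integer vectors whose entries outside `σ` are nonnegative.
The set `[m]` is `Fin m`, so the variables `t_1, …, t_m` are numbered `0, …, m - 1`. -/
def mon (m : ℕ) (σ : Finset (Fin m)) : AddSubmonoid (Fin m → ℤ) where
  carrier := {d | ∀ i, i ∉ σ → 0 ≤ d i}
  zero_mem' := fun _ _ => le_rfl
  add_mem' := fun ha hb i hi => add_nonneg (ha i hi) (hb i hi)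

theorem mon_mono {m : ℕ} {σ τ : Finset (Fin m)} (h : σ ⊆ τ) : mon m σ ≤ mon m τ :=
  fun _ hd i hi => hd i fun h' => hi (h h')

/-- A vector of natural numbers, as an element of `σ⁻¹ℕ^m`. -/
def natMon {m : ℕ} (σ : Finset (Fin m)) (a : Fin m → ℕ) : mon m σ :=
  ⟨fun i => (a i : ℤ), fun _ _ => Int.natCast_nonneg _⟩

/-- `R_σ = R[t_i⁻¹ | i ∈ σ]`, the monoid algebra of `σ⁻¹ℕ^m`; in particular `R_∅ = R` is the
polynomial ring `k[t_1, …, t_m]`. -/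
abbrev locRing (k : Type u) [Field k] (m : ℕ) (σ : Finset (Fin m)) : Type u :=
  AddMonoidAlgebra k (mon m σ)

/-- The localization map `R_σ → R_τ` for `σ ⊆ τ`. -/
def incl (k : Type u) [Field k] {m : ℕ} {σ τ : Finset (Fin m)} (h : σ ⊆ τ) :
    locRing k m σ →+* locRing k m τ :=
  AddMonoidAlgebra.mapDomainRingHom k (AddSubmonoid.inclusion (mon_mono h))

theorem incl_single {k : Type u} [Field k] {m : ℕ} {σ τ : Finset (Fin m)} (h : σ ⊆ τ)
    (g : mon m σ) (c : k) :
    incl k h (AddMonoidAlgebra.single g c) =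
      AddMonoidAlgebra.single (AddSubmonoid.inclusion (mon_mono h) g) c :=
  AddMonoidAlgebra.mapDomain_single

theorem incl_smul {k : Type u} [Field k] {m : ℕ} {σ τ : Finset (Fin m)} (h : σ ⊆ τ)
    (c : k) (r : locRing k m σ) : incl k h (c • r) = c • incl k h r :=
  map_smul (AddMonoidAlgebra.mapDomainAlgHom k k
    (AddSubmonoid.inclusion (mon_mono h) : mon m σ →+ mon m τ)) c r

theorem incl_incl {k : Type u} [Field k] {m : ℕ} {σ τ υ : Finset (Fin m)} (h : σ ⊆ τ)
    (h' : τ ⊆ υ) (r : locRing k m σ) :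
    incl k h' (incl k h r) = incl k (Finset.Subset.trans h h') r := by
  rw [← RingHom.comp_apply]
  congr 1
  exact (AddMonoidAlgebra.mapDomainRingHom_comp _ _).symm

theorem incl_refl {k : Type u} [Field k] {m : ℕ} {σ : Finset (Fin m)} (h : σ ⊆ σ)
    (r : locRing k m σ) : incl k h r = r := by
  have : incl k h = RingHom.id _ := AddMonoidAlgebra.mapDomainRingHom_id
  rw [this, RingHom.id_apply]

theorem exists_of_coeff_incl_ne_zero {k : Type u} [Field k] {m : ℕ} {σ τ : Finset (Fin m)}
    (h : σ ⊆ τ) (r : locRing k m σ) (g : mon m τ) (hg : (incl k h r).coeff g ≠ 0) :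
    ∃ g', AddSubmonoid.inclusion (mon_mono h) g' = g ∧ r.coeff g' ≠ 0 := by
  change (AddMonoidAlgebra.mapDomain (AddSubmonoid.inclusion (mon_mono h)) r).coeff g ≠ 0 at hg
  rw [AddMonoidAlgebra.coeff_mapDomain] at hg
  by_cases hex : ∃ g', AddSubmonoid.inclusion (mon_mono h) g' = g
  · obtain ⟨g', rfl⟩ := hex
    rw [Finsupp.mapDomain_apply (AddSubmonoid.inclusion_injective _)] at hg
    exact ⟨g', rfl, hg⟩
  · exact absurd (Finsupp.mapDomain_of_notMem_range _ _ hex) hg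

/-- The variable `t_i` as an element of `R_σ`. -/
def var (k : Type u) [Field k] {m : ℕ} (σ : Finset (Fin m)) (i : Fin m) : locRing k m σ :=
  AddMonoidAlgebra.single (natMon σ (Pi.single i 1)) 1

/-- A finitely generated `σ⁻¹ℕ^m`-graded `R_σ`-module. The grading is indexed by `ℤ^m` and vanishes
outside `σ⁻¹ℕ^m`; `deg d` is the part in multidegree `d`. -/
structure GrMod (k : Type u) [Field k] (m : ℕ) (σ : Finset (Fin m)) where
  carrier : Type u
  [addCommGroup : AddCommGroup carrier]
  [moduleBase : Module k carrier]
  [module : Module (locRing k m σ) carrier]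
  [isScalarTower : IsScalarTower k (locRing k m σ) carrier]
  [finite : Module.Finite (locRing k m σ) carrier]
  deg : (Fin m → ℤ) → Submodule k carrier
  isInternal : DirectSum.IsInternal deg
  smul_mem : ∀ (g : mon m σ) (d : Fin m → ℤ) (x : carrier), x ∈ deg d →
    (AddMonoidAlgebra.single g (1 : k) : locRing k m σ) • x ∈ deg (g + d)
  deg_eq_bot : ∀ d, d ∉ mon m σ → deg d = ⊥

instance {k : Type u} [Field k] {m : ℕ} {σ : Finset (Fin m)} :
    CoeSort (GrMod k m σ) (Type u) := ⟨GrMod.carrier⟩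

attribute [instance] GrMod.addCommGroup GrMod.moduleBase GrMod.module GrMod.isScalarTower
  GrMod.finite

section Grading

variable {k : Type u} [Field k] {m : ℕ} {σ τ : Finset (Fin m)}

theorem isInternal_of_proj {ι : Type} [DecidableEq ι] {M : Type u} [AddCommGroup M] [Module k M]
    (A : ι → Submodule k M) (p : ι → M →+ M) (h1 : ∀ d, ∀ x ∈ A d, p d x = x)
    (h2 : ∀ d e, d ≠ e → ∀ x ∈ A e, p d x = 0) (h3 : ∀ x, x ∈ ⨆ d, A d) :
    DirectSum.IsInternal A := by
  apply DirectSum.isInternal_submodule_of_iSupIndep_of_iSup_eq_top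
  · rw [iSupIndep_def]
    intro d
    rw [Submodule.disjoint_def]
    intro x hx hx'
    have : p d x = 0 := by
      refine Submodule.iSup_induction (fun e => ⨆ (_ : e ≠ d), A e)
        (motive := fun y => p d y = 0) hx' ?_ (map_zero _) ?_
      · intro e y hy
        by_cases he : e = d
        · subst he
          simp at hy
          simp [hy]
        · simp only [ne_eq, he, not_false_eq_true, iSup_pos] at hy
          exact h2 d e (Ne.symm he) y hy
      · intro y z hy hz
        rw [map_add, hy, hz, add_zero]
    rw [← h1 d x hx, this]
  · exact eq_top_iff.2 fun x _ => h3 x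

theorem single_smul_eq (M : GrMod k m σ) (g : mon m σ) (c : k) (x : M) :
    (AddMonoidAlgebra.single g c : locRing k m σ) • x =
      c • ((AddMonoidAlgebra.single g (1 : k) : locRing k m σ) • x) := by
  rw [← smul_assoc, AddMonoidAlgebra.smul_single, smul_eq_mul, mul_one]

theorem GrMod.single_smul_mem (M : GrMod k m σ) (g : mon m σ) (c : k) {d : Fin m → ℤ} {x : M}
    (hx : x ∈ M.deg d) :
    (AddMonoidAlgebra.single g c : locRing k m σ) • x ∈ M.deg (g + d) := by
  rw [single_smul_eq]
  exact Submodule.smul_mem _ _ (M.smul_mem g d x hx)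

theorem GrMod.mem_iSup (M : GrMod k m σ) (x : M) : x ∈ ⨆ d, M.deg d := by
  rw [M.isInternal.submodule_iSup_eq_top]
  trivial

theorem GrMod.bijective (M : GrMod k m σ) :
    Function.Bijective (DirectSum.coeLinearMap M.deg) := M.isInternal

/-- Projection of a graded module to its part in multidegree `d`. -/
def GrMod.proj (M : GrMod k m σ) (d : Fin m → ℤ) : M →ₗ[k] M :=
  (M.deg d).subtype ∘ₗ DirectSum.component k (Fin m → ℤ) (fun e => M.deg e) d ∘ₗ
    (LinearEquiv.ofBijective (DirectSum.coeLinearMap M.deg) M.bijective).symm.toLinearMap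

theorem GrMod.proj_mem (M : GrMod k m σ) (d : Fin m → ℤ) (x : M) : M.proj d x ∈ M.deg d :=
  Submodule.coe_mem _

theorem GrMod.proj_of_mem (M : GrMod k m σ) {d e : Fin m → ℤ} {x : M} (hx : x ∈ M.deg e) :
    M.proj d x = if e = d then x else 0 := by
  have : (LinearEquiv.ofBijective (DirectSum.coeLinearMap M.deg) M.bijective).symm x =
      DirectSum.lof k _ (fun e => M.deg e) e ⟨x, hx⟩ := by
    rw [LinearEquiv.symm_apply_eq, LinearEquiv.ofBijective_apply, DirectSum.coeLinearMap_lof]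
  simp only [GrMod.proj, LinearMap.comp_apply, LinearEquiv.coe_coe, this]
  split_ifs with h
  · subst h
    simp [DirectSum.component.lof_self]
  · simp [DirectSum.component.of, h]

theorem GrMod.proj_smul (M : GrMod k m σ) (g : mon m σ) (c : k) (d : Fin m → ℤ) (x : M) :
    M.proj d ((AddMonoidAlgebra.single g c : locRing k m σ) • x) =
      (AddMonoidAlgebra.single g c : locRing k m σ) • M.proj (d - g) x := by
  refine Submodule.iSup_induction M.deg
    (motive := fun x => M.proj d ((AddMonoidAlgebra.single g c : locRing k m σ) • x) =
      (AddMonoidAlgebra.single g c : locRing k m σ) • M.proj (d - g) x) (M.mem_iSup x) ?_ ?_ ?_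
  · intro e y hy
    rw [M.proj_of_mem (M.single_smul_mem g c hy), M.proj_of_mem hy]
    by_cases h : e = d - g
    · subst h
      simp
    · have : (g : Fin m → ℤ) + e ≠ d := fun h' => h (by rw [← h']; abel)
      simp [h, this]
  · simp
  · intro y z hy hz
    rw [smul_add, map_add, map_add, smul_add, hy, hz]

theorem smul_induction {M : Type u} [AddCommGroup M] [Module (locRing k m σ) M]
    (p : M → Prop) (h0 : p 0) (hadd : ∀ x y, p x → p y → p (x + y))
    {x : M} (h : ∀ (g : mon m σ) (c : k),
      p ((AddMonoidAlgebra.single g c : locRing k m σ) • x)) (r : locRing k m σ) :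
    p (r • x) := by
  induction r using AddMonoidAlgebra.induction_linear with
  | zero => simpa using h0
  | add f g hf hg => rw [add_smul]; exact hadd _ _ hf hg
  | single g c => exact h g c

end Grading

section Constructions

variable {k : Type u} [Field k] {m : ℕ} {σ τ υ : Finset (Fin m)}

/-- The zero graded module. -/
def GrMod.zero (k : Type u) [Field k] (m : ℕ) (σ : Finset (Fin m)) : GrMod k m σ where
  carrier := PUnit.{u + 1}
  deg := fun _ => ⊥
  isInternal := isInternal_of_proj _ (fun _ => 0) (fun _ _ _ => Subsingleton.elim _ _)
    (fun _ _ _ _ _ => Subsingleton.elim _ _)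
    (fun x => by rw [Subsingleton.elim x 0]; exact Submodule.zero_mem _)
  smul_mem := fun _ _ x _ => (Submodule.mem_bot k).2 (Subsingleton.elim _ _)
  deg_eq_bot := fun _ _ => rfl

/-- The direct sum of two graded modules. -/
def GrMod.prod (M N : GrMod k m σ) : GrMod k m σ where
  carrier := M × N
  deg := fun d => (M.deg d).prod (N.deg d)
  isInternal := by
    refine isInternal_of_proj _
      (fun d => ((M.proj d).prodMap (N.proj d)).toAddMonoidHom) ?_ ?_ ?_
    · rintro d ⟨x, y⟩ ⟨hx, hy⟩
      simp only [LinearMap.toAddMonoidHom_coe, LinearMap.prodMap_apply]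
      rw [M.proj_of_mem hx, N.proj_of_mem hy, if_pos rfl, if_pos rfl]
    · rintro d e hde ⟨x, y⟩ ⟨hx, hy⟩
      simp only [LinearMap.toAddMonoidHom_coe, LinearMap.prodMap_apply]
      rw [M.proj_of_mem hx, N.proj_of_mem hy, if_neg hde.symm, if_neg hde.symm, Prod.mk_zero_zero]
    · rintro ⟨x, y⟩
      have hx : ∀ x : M, ((x, 0) : M × N) ∈ ⨆ d, (M.deg d).prod (N.deg d) := fun x =>
        Submodule.iSup_induction M.deg
          (motive := fun x => ((x, 0) : M × N) ∈ ⨆ d, (M.deg d).prod (N.deg d)) (M.mem_iSup x)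
          (fun d y hy => Submodule.mem_iSup_of_mem d ⟨hy, Submodule.zero_mem _⟩)
          (Submodule.zero_mem _)
          (fun y z hy hz => by simpa using Submodule.add_mem _ hy hz)
      have hy : ∀ y : N, ((0, y) : M × N) ∈ ⨆ d, (M.deg d).prod (N.deg d) := fun y =>
        Submodule.iSup_induction N.deg
          (motive := fun y => ((0, y) : M × N) ∈ ⨆ d, (M.deg d).prod (N.deg d)) (N.mem_iSup y)
          (fun d y hy => Submodule.mem_iSup_of_mem d ⟨Submodule.zero_mem _, hy⟩)
          (Submodule.zero_mem _)
          (fun y z hy hz => by simpa using Submodule.add_mem _ hy hz)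
      simpa using Submodule.add_mem _ (hx x) (hy y)
  smul_mem := fun g d x hx => ⟨M.smul_mem g d x.1 hx.1, N.smul_mem g d x.2 hx.2⟩
  deg_eq_bot := fun d hd => by rw [M.deg_eq_bot d hd, N.deg_eq_bot d hd, Submodule.prod_bot]

/-- `t^a R_σ`, written as the free `R_σ`-module on one generator `1` of multidegree `a ∈ ℕ^m`. -/
def GrMod.shift (k : Type u) [Field k] {m : ℕ} (σ : Finset (Fin m)) (a : Fin m → ℕ) :
    GrMod k m σ where
  carrier := locRing k m σ
  deg := fun d =>
    { carrier := {r | ∀ g : mon m σ, r.coeff g ≠ 0 → (g + natMon σ a : Fin m → ℤ) = d}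
      zero_mem' := fun g hg => absurd rfl hg
      add_mem' := fun {r s} hr hs g hg => by
        by_cases h : r.coeff g = 0
        · refine hs g fun h' => hg ?_
          simp [h, h']
        · exact hr g h
      smul_mem' := fun c r hr g hg => hr g fun h => hg (by simp [h]) }
  isInternal := by
    refine isInternal_of_proj _
      (fun d =>
        { toFun := fun r => AddMonoidAlgebra.ofCoeff
            (r.coeff.filter fun g => (g + natMon σ a : Fin m → ℤ) = d)
          map_zero' := by simp [Finsupp.filter_zero]
          map_add' := fun r s => by
            ext g
            simp [Finsupp.filter_add] }) ?_ ?_ ?_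
    · intro d r hr
      ext g
      by_cases h : (g + natMon σ a : Fin m → ℤ) = d
      · simp [h]
      · have : r.coeff g = 0 := by
          by_contra h'
          exact h (hr g h')
        simp [Finsupp.filter_apply, this]
    · intro d e hde r hr
      ext g
      by_cases h : (g + natMon σ a : Fin m → ℤ) = d
      · have : r.coeff g = 0 := by
          by_contra h'
          exact hde (h.symm.trans (hr g h'))
        simp [Finsupp.filter_apply, this]
      · simp [h]
    · intro r
      induction r using AddMonoidAlgebra.induction_linear with
      | zero => exact Submodule.zero_mem _
      | add f g hf hg => exact Submodule.add_mem _ hf hg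
      | single g c =>
        refine Submodule.mem_iSup_of_mem (g + natMon σ a : Fin m → ℤ) fun h hh => ?_
        rw [AddMonoidAlgebra.coeff_single, Finsupp.single_apply] at hh
        have : g = h := by
          by_contra h'
          exact hh (if_neg h')
        rw [this]
  smul_mem := fun g d r hr h hh => by
    rw [smul_eq_mul] at hh
    obtain ⟨h', rfl⟩ : ∃ h', h = g + h' := by
      by_contra hne
      push Not at hne
      exact hh (AddMonoidAlgebra.coeff_single_mul_of_forall_add_ne _ _ fun d hd => hne d hd.symm)
    rw [AddMonoidAlgebra.coeff_single_mul_eq_mul_coeff h'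
      (fun _ _ => add_right_inj g), one_mul] at hh
    rw [AddSubmonoid.coe_add, add_assoc, hr h' hh]
  deg_eq_bot := fun d hd => by
    rw [eq_bot_iff]
    intro r hr
    rw [Submodule.mem_bot]
    ext g
    by_contra h
    exact hd ((hr g h) ▸ (g + natMon σ a).2)

theorem var_mem_shift (i : Fin m) (a : Fin m → ℕ) (d : Fin m → ℤ)
    (h : (fun j => (((Pi.single i 1 : Fin m → ℕ) j : ℕ) : ℤ) + (a j : ℤ)) = d) :
    var k σ i ∈ (GrMod.shift k σ a).deg d := by
  intro g hg
  rw [var, AddMonoidAlgebra.coeff_single, Finsupp.single_apply] at hg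
  by_cases hg' : natMon σ (Pi.single i 1) = g
  · rw [← hg', ← h]
    rfl
  · exact absurd (if_neg hg') hg

/-- The quotient of a graded module by the submodule generated by a set of homogeneous elements. -/
def GrMod.quotient (M : GrMod k m σ) (s : Set M) (hs : ∀ x ∈ s, ∃ d, x ∈ M.deg d) :
    GrMod k m σ where
  carrier := M ⧸ Submodule.span (locRing k m σ) s
  deg := fun d =>
    (M.deg d).map ((Submodule.span (locRing k m σ) s).mkQ.restrictScalars k)
  isInternal := by
    have key : ∀ x ∈ Submodule.span (locRing k m σ) s, ∀ d,
        M.proj d x ∈ Submodule.span (locRing k m σ) s := by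
      intro x hx
      induction hx using Submodule.span_induction with
      | mem x hx =>
        intro d
        obtain ⟨e, he⟩ := hs x hx
        rw [M.proj_of_mem he]
        split_ifs
        · exact Submodule.subset_span hx
        · exact Submodule.zero_mem _
      | zero => intro d; rw [map_zero]; exact Submodule.zero_mem _
      | add x y _ _ hx hy =>
        intro d
        rw [map_add]
        exact Submodule.add_mem _ (hx d) (hy d)
      | smul r x _ hx =>
        refine smul_induction (fun y => ∀ d, M.proj d y ∈ Submodule.span (locRing k m σ) s)
          (fun d => by rw [map_zero]; exact Submodule.zero_mem _)
          (fun y z hy hz d => by rw [map_add]; exact Submodule.add_mem _ (hy d) (hz d))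
          (fun g c d => ?_) r
        rw [M.proj_smul]
        exact Submodule.smul_mem _ _ (hx _)
    refine isInternal_of_proj _
      (fun d => QuotientAddGroup.map (Submodule.span (locRing k m σ) s).toAddSubgroup
        (Submodule.span (locRing k m σ) s).toAddSubgroup (M.proj d).toAddMonoidHom
        (fun x hx => key x hx d)) ?_ ?_ ?_
    · rintro d _ ⟨x, hx, rfl⟩
      change Submodule.Quotient.mk (M.proj d x) = Submodule.Quotient.mk x
      rw [M.proj_of_mem hx, if_pos rfl]
    · rintro d e hde _ ⟨x, hx, rfl⟩
      change Submodule.Quotient.mk (M.proj d x) = _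
      rw [M.proj_of_mem hx, if_neg hde.symm, Submodule.Quotient.mk_zero]
    · intro x
      obtain ⟨x, rfl⟩ := Submodule.mkQ_surjective _ x
      rw [← Submodule.map_iSup]
      exact ⟨x, M.mem_iSup x, rfl⟩
  smul_mem := by
    rintro g d _ ⟨x, hx, rfl⟩
    exact ⟨_, M.smul_mem g d x hx, Submodule.Quotient.mk_smul _ _ x⟩
  deg_eq_bot := fun d hd => by rw [M.deg_eq_bot d hd, Submodule.map_bot]

/-- For a ring map `ι : A → B`, an `A`-module `M` and a `B`-module `N`, the `ι`-semilinear map `f`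
induces an isomorphism `B ⊗_A M ≅ N`. -/
def InducesIso {A B M N : Type u} [CommRing A] [CommRing B] (ι : A →+* B) [AddCommGroup M]
    [AddCommGroup N] [Module A M] [Module B N] (f : M →ₛₗ[ι] N) : Prop :=
  letI : Algebra A B := ι.toAlgebra
  letI : Module A N := Module.compHom N ι
  letI : IsScalarTower A B N := ⟨fun a b x => mul_smul (ι a) b x⟩
  IsBaseChange B ({ toFun := f, map_add' := f.map_add, map_smul' := f.map_smulₛₗ } : M →ₗ[A] N)

theorem InducesIso.prodMap {A B M N M' N' : Type u} [CommRing A] [CommRing B] {ι : A →+* B}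
    [AddCommGroup M] [AddCommGroup N] [Module A M] [Module B N]
    [AddCommGroup M'] [AddCommGroup N'] [Module A M'] [Module B N']
    {f : M →ₛₗ[ι] N} {f' : M' →ₛₗ[ι] N'} (hf : InducesIso ι f) (hf' : InducesIso ι f')
    (F : M × M' →ₛₗ[ι] N × N') (hF : ∀ x, F x = (f x.1, f' x.2)) : InducesIso ι F := by
  let _ : Algebra A B := ι.toAlgebra
  let _ : Module A N := Module.compHom N ι
  have _ : IsScalarTower A B N := ⟨fun a b x => mul_smul (ι a) b x⟩
  let _ : Module A N' := Module.compHom N' ι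
  have _ : IsScalarTower A B N' := ⟨fun a b x => mul_smul (ι a) b x⟩
  let g : M →ₗ[A] N := { toFun := f, map_add' := f.map_add, map_smul' := f.map_smulₛₗ }
  let g' : M' →ₗ[A] N' := { toFun := f', map_add' := f'.map_add, map_smul' := f'.map_smulₛₗ }
  have hg : IsBaseChange B g := hf
  have hg' : IsBaseChange B g' := hf'
  let G : M × M' →ₗ[A] N × N' :=
    { toFun := F, map_add' := F.map_add, map_smul' := F.map_smulₛₗ }
  have hG : G = g.prodMap g' := LinearMap.ext hF
  have key : IsBaseChange B G := hG ▸ IsBaseChange.prodMap g g' hg hg'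
  exact key

theorem InducesIso.of_subsingleton {A B M N : Type u} [CommRing A] [CommRing B] {ι : A →+* B}
    [AddCommGroup M] [AddCommGroup N] [Module A M] [Module B N] [Subsingleton M] [Subsingleton N]
    (f : M →ₛₗ[ι] N) : InducesIso ι f := by
  let _ : Algebra A B := ι.toAlgebra
  let _ : Module A N := Module.compHom N ι
  have _ : IsScalarTower A B N := ⟨fun a b x => mul_smul (ι a) b x⟩
  exact IsBaseChange.of_equiv (0 : TensorProduct A B M ≃ₗ[B] N) fun _ => Subsingleton.elim _ _

theorem InducesIso.ringHom {A B : Type u} [CommRing A] [CommRing B] (ι : A →+* B)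
    (f : A →ₛₗ[ι] B) (hf : ∀ x, f x = ι x) : InducesIso ι f := by
  let _ : Algebra A B := ι.toAlgebra
  let G : A →ₗ[A] B := { toFun := f, map_add' := f.map_add, map_smul' := f.map_smulₛₗ }
  have hG : G = Algebra.linearMap A B := LinearMap.ext hf
  have key : IsBaseChange B G := hG ▸ IsBaseChange.linearMap A B
  exact key

theorem InducesIso.of_comp {R A B M N O : Type u} [CommRing R] [CommRing A] [CommRing B]
    [Algebra R A] [Algebra R B] {ι : A →+* B} (hι : ∀ r, ι (algebraMap R A r) = algebraMap R B r)
    [AddCommGroup M] [AddCommGroup N] [AddCommGroup O] [Module R M] [Module R N] [Module R O]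
    [Module A N] [Module B O] [IsScalarTower R A N] [IsScalarTower R B O]
    {f : M →ₗ[R] N} (hf : IsBaseChange A f) {g : M →ₗ[R] O} (hg : IsBaseChange B g)
    (F : N →ₛₗ[ι] O) (hF : ∀ x, F (f x) = g x) : InducesIso ι F := by
  let _ : Algebra A B := ι.toAlgebra
  have _ : IsScalarTower R A B := IsScalarTower.of_algebraMap_eq fun r => (hι r).symm
  let _ : Module A O := Module.compHom O ι
  have _ : IsScalarTower A B O := ⟨fun a b x => mul_smul (ι a) b x⟩
  have _ : IsScalarTower R A O := ⟨fun r a x => by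
    change ι (r • a) • x = r • (ι a • x)
    rw [Algebra.smul_def, map_mul, hι, mul_smul, algebraMap_smul]⟩
  let G : N →ₗ[A] O := { toFun := F, map_add' := F.map_add, map_smul' := F.map_smulₛₗ }
  have hG : (G.restrictScalars R).comp f = g := LinearMap.ext hF
  have key : IsBaseChange B G := hf.of_comp (hG ▸ hg)
  exact key

end Constructions

/-! ### The category of `K`-localized persistence modules -/

/-- A `K`-localized persistence module. A simplicial complex on the vertex set `[m]`, possibly with
ghost vertices and possibly empty, is a lower set of subsets of `[m]`. -/
structure LocMod (k : Type u) [Field k] {m : ℕ} (K : LowerSet (Finset (Fin m))) where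
  obj : ∀ σ : Finset (Fin m), σ ∉ K → GrMod k m σ
  map : ∀ {σ τ : Finset (Fin m)} (hσ : σ ∉ K) (hτ : τ ∉ K) (h : σ ⊆ τ),
    obj σ hσ →ₛₗ[incl k h] obj τ hτ
  map_mem : ∀ {σ τ : Finset (Fin m)} (hσ : σ ∉ K) (hτ : τ ∉ K) (h : σ ⊆ τ) (d : Fin m → ℤ)
    (x : obj σ hσ), x ∈ (obj σ hσ).deg d → map hσ hτ h x ∈ (obj τ hτ).deg d
  inducesIso : ∀ {σ τ : Finset (Fin m)} (hσ : σ ∉ K) (hτ : τ ∉ K) (h : σ ⊆ τ),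
    InducesIso (incl k h) (map hσ hτ h)
  map_id : ∀ {σ : Finset (Fin m)} (hσ : σ ∉ K) (x : obj σ hσ),
    map hσ hσ (Finset.Subset.refl σ) x = x
  map_comp : ∀ {σ τ υ : Finset (Fin m)} (hσ : σ ∉ K) (hτ : τ ∉ K) (hυ : υ ∉ K) (h : σ ⊆ τ)
    (h' : τ ⊆ υ) (x : obj σ hσ),
    map hτ hυ h' (map hσ hτ h x) = map hσ hυ (Finset.Subset.trans h h') x

namespace LocMod

variable {k : Type u} [Field k] {m : ℕ} {K : LowerSet (Finset (Fin m))}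

/-- Morphisms of `K`-localized persistence modules: degree-preserving `R_σ`-linear maps, compatible
with the transition maps. -/
@[ext]
structure Hom (M N : LocMod k K) where
  app : ∀ (σ : Finset (Fin m)) (hσ : σ ∉ K), M.obj σ hσ →ₗ[locRing k m σ] N.obj σ hσ
  app_mem : ∀ (σ : Finset (Fin m)) (hσ : σ ∉ K) (d : Fin m → ℤ) (x : M.obj σ hσ),
    x ∈ (M.obj σ hσ).deg d → app σ hσ x ∈ (N.obj σ hσ).deg d
  naturality : ∀ {σ τ : Finset (Fin m)} (hσ : σ ∉ K) (hτ : τ ∉ K) (h : σ ⊆ τ) (x : M.obj σ hσ),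
    app τ hτ (M.map hσ hτ h x) = N.map hσ hτ h (app σ hσ x)

instance : Category (LocMod k K) where
  Hom := Hom
  id M :=
    { app := fun _ _ => LinearMap.id
      app_mem := fun _ _ _ _ hx => hx
      naturality := fun _ _ _ _ => rfl }
  comp f g :=
    { app := fun σ hσ => (g.app σ hσ).comp (f.app σ hσ)
      app_mem := fun σ hσ d x hx => g.app_mem σ hσ d _ (f.app_mem σ hσ d x hx)
      naturality := fun hσ hτ h x => by
        rw [LinearMap.comp_apply, LinearMap.comp_apply, f.naturality, g.naturality] }

@[ext]
theorem hom_ext {M N : LocMod k K} {f g : M ⟶ N}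
    (h : ∀ (σ : Finset (Fin m)) (hσ : σ ∉ K) (x : M.obj σ hσ),
      Hom.app f σ hσ x = Hom.app g σ hσ x) : f = g :=
  Hom.ext (funext fun σ => funext fun hσ => LinearMap.ext (h σ hσ))

@[simp]
theorem id_app (M : LocMod k K) (σ : Finset (Fin m)) (hσ : σ ∉ K) :
    Hom.app (𝟙 M) σ hσ = LinearMap.id := rfl

@[simp]
theorem comp_app {M N P : LocMod k K} (f : M ⟶ N) (g : N ⟶ P) (σ : Finset (Fin m))
    (hσ : σ ∉ K) : Hom.app (f ≫ g) σ hσ = (Hom.app g σ hσ).comp (Hom.app f σ hσ) := rfl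

instance (M N : LocMod k K) : Zero (M ⟶ N) where
  zero :=
    { app := fun _ _ => 0
      app_mem := fun _ _ _ _ _ => Submodule.zero_mem _
      naturality := fun _ _ _ _ => (map_zero _).symm }

instance (M N : LocMod k K) : Add (M ⟶ N) where
  add f g :=
    { app := fun σ hσ => Hom.app f σ hσ + Hom.app g σ hσ
      app_mem := fun σ hσ d x hx =>
        Submodule.add_mem _ (Hom.app_mem f σ hσ d x hx) (Hom.app_mem g σ hσ d x hx)
      naturality := fun hσ hτ h x => by
        rw [LinearMap.add_apply, LinearMap.add_apply, Hom.naturality, Hom.naturality, map_add] }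

instance (M N : LocMod k K) : Neg (M ⟶ N) where
  neg f :=
    { app := fun σ hσ => -Hom.app f σ hσ
      app_mem := fun σ hσ d x hx => Submodule.neg_mem _ (Hom.app_mem f σ hσ d x hx)
      naturality := fun hσ hτ h x => by
        rw [LinearMap.neg_apply, LinearMap.neg_apply, Hom.naturality, map_neg] }

@[simp]
theorem zero_app (M N : LocMod k K) (σ : Finset (Fin m)) (hσ : σ ∉ K) :
    Hom.app (0 : M ⟶ N) σ hσ = 0 := rfl

@[simp]
theorem add_app {M N : LocMod k K} (f g : M ⟶ N) (σ : Finset (Fin m)) (hσ : σ ∉ K) :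
    Hom.app (f + g) σ hσ = Hom.app f σ hσ + Hom.app g σ hσ := rfl

@[simp]
theorem neg_app {M N : LocMod k K} (f : M ⟶ N) (σ : Finset (Fin m)) (hσ : σ ∉ K) :
    Hom.app (-f) σ hσ = -Hom.app f σ hσ := rfl

instance (M N : LocMod k K) : AddCommGroup (M ⟶ N) where
  add_assoc f g h := by ext; simp [add_assoc]
  zero_add f := by ext; simp
  add_zero f := by ext; simp
  add_comm f g := by ext; simp [add_comm]
  neg_add_cancel f := by ext; simp
  nsmul := nsmulRec
  zsmul := zsmulRec

instance : Preadditive (LocMod k K) where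
  add_comp M N P f g h := by ext; simp
  comp_add M N P f g h := by ext; simp

/-- The zero object. -/
def zeroObj (k : Type u) [Field k] {m : ℕ} (K : LowerSet (Finset (Fin m))) : LocMod k K where
  obj := fun σ _ => GrMod.zero k m σ
  map := fun _ _ _ => 0
  map_mem := fun _ _ _ _ _ _ => Submodule.zero_mem _
  inducesIso := fun {σ τ} _ _ _ =>
    haveI : Subsingleton (GrMod.zero k m σ) := inferInstanceAs (Subsingleton PUnit)
    haveI : Subsingleton (GrMod.zero k m τ) := inferInstanceAs (Subsingleton PUnit)
    InducesIso.of_subsingleton _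
  map_id := fun _ _ => rfl
  map_comp := fun _ _ _ _ _ _ => rfl

instance : HasZeroObject (LocMod k K) where
  zero := ⟨zeroObj k K, by
    rw [IsZero.iff_id_eq_zero]
    ext
    rfl⟩

/-- The direct sum of two objects, computed pointwise. -/
def prod (M N : LocMod k K) : LocMod k K where
  obj := fun σ hσ => (M.obj σ hσ).prod (N.obj σ hσ)
  map := fun hσ hτ h =>
    { toFun := fun x => (M.map hσ hτ h x.1, N.map hσ hτ h x.2)
      map_add' := fun _ _ => Prod.ext (map_add _ _ _) (map_add _ _ _)
      map_smul' := fun _ _ => Prod.ext (map_smulₛₗ _ _ _) (map_smulₛₗ _ _ _) }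
  map_mem := fun hσ hτ h d x hx => ⟨M.map_mem hσ hτ h d x.1 hx.1, N.map_mem hσ hτ h d x.2 hx.2⟩
  inducesIso := fun hσ hτ h =>
    InducesIso.prodMap (M.inducesIso hσ hτ h) (N.inducesIso hσ hτ h) _ fun _ => rfl
  map_id := fun hσ x => Prod.ext (M.map_id hσ x.1) (N.map_id hσ x.2)
  map_comp := fun hσ hτ hυ h h' x =>
    Prod.ext (M.map_comp hσ hτ hυ h h' x.1) (N.map_comp hσ hτ hυ h h' x.2)

/-- The biproduct bicone on the pointwise direct sum. -/
def prodBicone (M N : LocMod k K) : BinaryBicone M N where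
  pt := prod M N
  fst :=
    { app := fun σ hσ => LinearMap.fst _ (M.obj σ hσ) (N.obj σ hσ)
      app_mem := fun _ _ _ _ hx => hx.1
      naturality := fun _ _ _ _ => rfl }
  snd :=
    { app := fun σ hσ => LinearMap.snd _ (M.obj σ hσ) (N.obj σ hσ)
      app_mem := fun _ _ _ _ hx => hx.2
      naturality := fun _ _ _ _ => rfl }
  inl :=
    { app := fun σ hσ => LinearMap.inl _ (M.obj σ hσ) (N.obj σ hσ)
      app_mem := fun _ _ _ _ hx => ⟨hx, Submodule.zero_mem _⟩
      naturality := fun _ _ _ _ => Prod.ext rfl (map_zero _).symm }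
  inr :=
    { app := fun σ hσ => LinearMap.inr _ (M.obj σ hσ) (N.obj σ hσ)
      app_mem := fun _ _ _ _ hx => ⟨Submodule.zero_mem _, hx⟩
      naturality := fun _ _ _ _ => Prod.ext (map_zero _).symm rfl }
  inl_fst := rfl
  inl_snd := rfl
  inr_fst := rfl
  inr_snd := rfl

instance : HasBinaryBiproducts (LocMod k K) where
  has_binary_biproduct M N := hasBinaryBiproduct_of_total (prodBicone M N) (by
    refine hom_ext fun σ hσ x => Prod.ext ?_ ?_
    · exact add_zero _
    · exact zero_add _)

instance : HasFiniteBiproducts (LocMod k K) :=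
  haveI : HasFiniteProducts (LocMod k K) := hasFiniteProducts_of_has_binary_and_terminal
  HasFiniteBiproducts.of_hasFiniteProducts

/-- The rank of `M`: the dimension over `k` of the `ℤ^m`-graded `R_{[m]}`-module `M_{[m]}`, that is,
of its part in multidegree `0`. -/
def rank (M : LocMod k K) (h : Finset.univ ∉ K) : ℕ :=
  Module.finrank k ((M.obj Finset.univ h).deg 0)

end LocMod

/-! ### The `K`-localization functor, on objects -/

section Localization

variable {k : Type u} [Field k] {m : ℕ} {σ τ υ : Finset (Fin m)}

/-- `R_σ` as an algebra over `R = R_∅`. -/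
@[reducible]
def algebraBase (k : Type u) [Field k] {m : ℕ} (σ : Finset (Fin m)) :
    Algebra (locRing k m ∅) (locRing k m σ) :=
  (incl k (Finset.empty_subset σ)).toAlgebra

attribute [local instance] algebraBase

open scoped TensorProduct

theorem tower_base (σ : Finset (Fin m)) :
    IsScalarTower k (locRing k m ∅) (locRing k m σ) :=
  ⟨fun c a b => by
    rw [Algebra.smul_def (c • a) b, Algebra.smul_def a b, ← smul_mul_assoc]
    congr 1
    exact incl_smul _ c a⟩

attribute [local instance] tower_base

/-- The balanced biadditive map inducing the projection of `R_σ ⊗_R N` to multidegree `d`. -/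
def tensorProj (σ : Finset (Fin m)) (N : GrMod k m ∅) (d : Fin m → ℤ) :
    locRing k m σ →+ N →+ (locRing k m σ ⊗[locRing k m ∅] N) :=
  (Finsupp.liftAddHom fun g : mon m σ =>
    AddMonoidHom.mk' (fun c : k => AddMonoidHom.mk'
        (fun x : N => (AddMonoidAlgebra.single g c : locRing k m σ) ⊗ₜ[locRing k m ∅]
          (N.proj (d - g) x))
        (fun x y => by rw [map_add, TensorProduct.tmul_add]))
      (fun c c' => by
        ext x
        simp [AddMonoidAlgebra.single_add, TensorProduct.add_tmul])).comp
  (AddMonoidHom.mk' AddMonoidAlgebra.coeff fun _ _ => rfl)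

theorem tensorProj_single (N : GrMod k m ∅) (d : Fin m → ℤ) (g : mon m σ) (c : k) (x : N) :
    tensorProj σ N d (AddMonoidAlgebra.single g c) x =
      (AddMonoidAlgebra.single g c : locRing k m σ) ⊗ₜ[locRing k m ∅] (N.proj (d - g) x) := by
  have h := Finsupp.liftAddHom_apply_single (fun g : mon m σ =>
    AddMonoidHom.mk' (fun c : k => AddMonoidHom.mk'
        (fun x : N => (AddMonoidAlgebra.single g c : locRing k m σ) ⊗ₜ[locRing k m ∅]
          (N.proj (d - g) x))
        (fun x y => by rw [map_add, TensorProduct.tmul_add]))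
      (fun c c' => by
        ext x
        simp [AddMonoidAlgebra.single_add, TensorProduct.add_tmul])) g c
  exact DFunLike.congr_fun h x

theorem tensorProj_balanced (N : GrMod k m ∅) (d : Fin m → ℤ) (a : locRing k m ∅)
    (r : locRing k m σ) (x : N) :
    tensorProj σ N d (a • r) x = tensorProj σ N d r (a • x) := by
  induction r using AddMonoidAlgebra.induction_linear with
  | zero => simp
  | add r s hr hs => rw [smul_add, map_add, map_add, AddMonoidHom.add_apply,
      AddMonoidHom.add_apply, hr, hs]
  | single g c =>
    induction a using AddMonoidAlgebra.induction_linear with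
    | zero => simp
    | add a b ha hb => rw [add_smul, map_add, AddMonoidHom.add_apply, ha, hb, add_smul, map_add]
    | single h e =>
      have h1 : (AddMonoidAlgebra.single h e : locRing k m ∅) •
          (AddMonoidAlgebra.single g c : locRing k m σ) =
          AddMonoidAlgebra.single
            (AddSubmonoid.inclusion (mon_mono (Finset.empty_subset σ)) h + g) (e * c) := by
        rw [Algebra.smul_def, ← AddMonoidAlgebra.single_mul_single]
        congr 1
        exact incl_single _ _ _
      rw [h1, tensorProj_single, tensorProj_single, N.proj_smul, ← TensorProduct.smul_tmul, h1]
      congr 3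
      rw [AddSubmonoid.coe_add, AddSubmonoid.coe_inclusion]
      abel

/-- The part of `R_σ ⊗_R N` in multidegree `d`, spanned by the `t^g ⊗ x` with `g + |x| = d`. -/
def tensorDeg (σ : Finset (Fin m)) (N : GrMod k m ∅) (d : Fin m → ℤ) :
    Submodule k (locRing k m σ ⊗[locRing k m ∅] N) :=
  Submodule.span k
    {z | ∃ (g : mon m σ) (e : Fin m → ℤ) (x : N), x ∈ N.deg e ∧ g + e = d ∧
      z = (AddMonoidAlgebra.single g (1 : k) : locRing k m σ) ⊗ₜ[locRing k m ∅] x}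

/-- The localization `R_σ ⊗_R N`. -/
def GrMod.localize (σ : Finset (Fin m)) (N : GrMod k m ∅) : GrMod k m σ where
  carrier := locRing k m σ ⊗[locRing k m ∅] N
  deg := tensorDeg σ N
  isInternal := by
    have hs : ∀ (g : mon m σ) (c : k) (x : N),
        ((AddMonoidAlgebra.single g c : locRing k m σ) ⊗ₜ[locRing k m ∅] x) =
        c • ((AddMonoidAlgebra.single g (1 : k) : locRing k m σ) ⊗ₜ[locRing k m ∅] x) := by
      intro g c x
      rw [TensorProduct.smul_tmul', AddMonoidAlgebra.smul_single, smul_eq_mul, mul_one]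
    have hk : ∀ (d : Fin m → ℤ) (c : k) (z : locRing k m σ ⊗[locRing k m ∅] N),
        TensorProduct.liftAddHom (tensorProj σ N d) (tensorProj_balanced N d) (c • z) =
        c • TensorProduct.liftAddHom (tensorProj σ N d) (tensorProj_balanced N d) z := by
      intro d c z
      induction z using TensorProduct.induction_on with
      | zero => simp
      | add y z hy hz => rw [smul_add, map_add, hy, hz, map_add, smul_add]
      | tmul r x =>
        rw [TensorProduct.smul_tmul', TensorProduct.liftAddHom_tmul,
          TensorProduct.liftAddHom_tmul]
        induction r using AddMonoidAlgebra.induction_linear with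
        | zero => simp
        | add r s hr hs => rw [smul_add, map_add, AddMonoidHom.add_apply, hr, hs, map_add,
            AddMonoidHom.add_apply, smul_add]
        | single g e =>
          rw [AddMonoidAlgebra.smul_single, tensorProj_single, tensorProj_single,
            TensorProduct.smul_tmul', AddMonoidAlgebra.smul_single]
    refine isInternal_of_proj _
      (fun d => TensorProduct.liftAddHom (tensorProj σ N d) (tensorProj_balanced N d)) ?_ ?_ ?_
    · intro d z hz
      unfold tensorDeg at hz
      induction hz using Submodule.span_induction with
      | mem z hz =>
        obtain ⟨g, e, x, hx, rfl, rfl⟩ := hz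
        rw [TensorProduct.liftAddHom_tmul, tensorProj_single, N.proj_of_mem hx, if_pos]
        abel
      | zero => exact map_zero _
      | add y z _ _ hy hz => rw [map_add, hy, hz]
      | smul c z _ hz => rw [hk, hz]
    · intro d e hde z hz
      unfold tensorDeg at hz
      induction hz using Submodule.span_induction with
      | mem z hz =>
        obtain ⟨g, e, x, hx, rfl, rfl⟩ := hz
        rw [TensorProduct.liftAddHom_tmul, tensorProj_single, N.proj_of_mem hx, if_neg,
          TensorProduct.tmul_zero]
        rintro rfl
        exact hde (by abel)
      | zero => exact map_zero _
      | add y z _ _ hy hz => rw [map_add, hy, hz, add_zero]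
      | smul c z _ hz => rw [hk, hz, smul_zero]
    · intro z
      induction z using TensorProduct.induction_on with
      | zero => exact Submodule.zero_mem _
      | add y z hy hz => exact Submodule.add_mem _ hy hz
      | tmul r x =>
        induction r using AddMonoidAlgebra.induction_linear with
        | zero => rw [TensorProduct.zero_tmul]; exact Submodule.zero_mem _
        | add r s hr hs => rw [TensorProduct.add_tmul]; exact Submodule.add_mem _ hr hs
        | single g c =>
          rw [hs]
          refine Submodule.smul_mem _ _ ?_
          refine Submodule.iSup_induction N.deg (motive := fun x =>
            ((AddMonoidAlgebra.single g (1 : k) : locRing k m σ) ⊗ₜ[locRing k m ∅] x) ∈ _)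
            (N.mem_iSup x) ?_ ?_ ?_
          · intro e y hy
            exact Submodule.mem_iSup_of_mem ((g : Fin m → ℤ) + e)
              (Submodule.subset_span ⟨g, e, y, hy, rfl, rfl⟩)
          · rw [TensorProduct.tmul_zero]; exact Submodule.zero_mem _
          · intro y z hy hz
            rw [TensorProduct.tmul_add]
            exact Submodule.add_mem _ hy hz
  smul_mem := by
    intro g d z hz
    unfold tensorDeg at hz
    induction hz using Submodule.span_induction with
    | mem z hz =>
      obtain ⟨h, e, x, hx, rfl, rfl⟩ := hz
      refine Submodule.subset_span ⟨g + h, e, x, hx, ?_, ?_⟩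
      · rw [AddSubmonoid.coe_add, add_assoc]
      · rw [TensorProduct.smul_tmul', smul_eq_mul, AddMonoidAlgebra.single_mul_single, one_mul]
    | zero => rw [smul_zero]; exact Submodule.zero_mem _
    | add y z _ _ hy hz => rw [smul_add]; exact Submodule.add_mem _ hy hz
    | smul c z _ hz => rw [smul_comm]; exact Submodule.smul_mem _ _ hz
  deg_eq_bot := by
    intro d hd
    rw [tensorDeg, Submodule.span_eq_bot]
    rintro _ ⟨g, e, x, hx, rfl, rfl⟩
    by_cases he : e ∈ mon m (∅ : Finset (Fin m))
    · exact absurd ((mon m σ).add_mem g.2 (mon_mono (Finset.empty_subset σ) he)) hd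
    · rw [N.deg_eq_bot e he, Submodule.mem_bot] at hx
      rw [hx, TensorProduct.tmul_zero]

/-- The canonical map `R_σ ⊗_R N → R_τ ⊗_R N`. -/
def tensorMap (N : GrMod k m ∅) (h : σ ⊆ τ) :
    (locRing k m σ ⊗[locRing k m ∅] N) →ₛₗ[incl k h] (locRing k m τ ⊗[locRing k m ∅] N) :=
  let f : locRing k m σ →ₗ[locRing k m ∅] locRing k m τ :=
    { toFun := incl k h
      map_add' := map_add _
      map_smul' := fun a r => by
        rw [Algebra.smul_def, map_mul, RingHom.id_apply, Algebra.smul_def]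
        congr 1
        change incl k h (incl k _ a) = incl k _ a
        rw [incl_incl] }
  { toFun := f.rTensor N
    map_add' := map_add _
    map_smul' := fun r z => by
      induction z using TensorProduct.induction_on with
      | zero => rw [smul_zero, map_zero, smul_zero]
      | add y z hy hz => rw [smul_add, map_add, hy, hz, map_add, smul_add]
      | tmul s x =>
        rw [TensorProduct.smul_tmul', LinearMap.rTensor_tmul, LinearMap.rTensor_tmul,
          TensorProduct.smul_tmul']
        congr 1
        exact map_mul (incl k h) r s }

theorem tensorMap_tmul (N : GrMod k m ∅) (h : σ ⊆ τ) (r : locRing k m σ) (x : N) :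
    tensorMap N h (r ⊗ₜ[locRing k m ∅] x) = incl k h r ⊗ₜ[locRing k m ∅] x := rfl

theorem tensorMap_inducesIso (N : GrMod k m ∅) (h : σ ⊆ τ) :
    InducesIso (incl k h) (tensorMap N h) :=
  InducesIso.of_comp (R := locRing k m ∅) (incl_incl _ h)
    (TensorProduct.isBaseChange (locRing k m ∅) N (locRing k m σ))
    (TensorProduct.isBaseChange (locRing k m ∅) N (locRing k m τ)) (tensorMap N h)
    (fun x => by
      change tensorMap N h (1 ⊗ₜ[locRing k m ∅] x) = 1 ⊗ₜ[locRing k m ∅] x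
      rw [tensorMap_tmul, map_one])

theorem tensorMap_mem (N : GrMod k m ∅) (h : σ ⊆ τ) (d : Fin m → ℤ)
    (z : locRing k m σ ⊗[locRing k m ∅] N) (hz : z ∈ tensorDeg σ N d) :
    tensorMap N h z ∈ tensorDeg τ N d := by
  unfold tensorDeg at hz
  induction hz using Submodule.span_induction with
  | mem z hz =>
    obtain ⟨g, e, x, hx, rfl, rfl⟩ := hz
    refine Submodule.subset_span
      ⟨AddSubmonoid.inclusion (mon_mono h) g, e, x, hx, rfl, ?_⟩
    rw [tensorMap_tmul, incl_single]
  | zero => rw [map_zero]; exact Submodule.zero_mem _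
  | add y z _ _ hy hz => rw [map_add]; exact Submodule.add_mem _ hy hz
  | smul c z _ hz =>
    have : tensorMap N h (c • z) = c • tensorMap N h z := by
      rw [← algebraMap_smul (locRing k m σ) c z, map_smulₛₗ,
        ← algebraMap_smul (locRing k m τ) c (tensorMap N h z)]
      congr 1
      exact incl_single _ _ _
    rw [this]
    exact Submodule.smul_mem _ _ hz

theorem tensorMap_refl (N : GrMod k m ∅) (h : σ ⊆ σ) (z : locRing k m σ ⊗[locRing k m ∅] N) :
    tensorMap N h z = z := by
  induction z using TensorProduct.induction_on with
  | zero => exact map_zero _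
  | add y z hy hz => rw [map_add, hy, hz]
  | tmul r x => rw [tensorMap_tmul, incl_refl]

theorem tensorMap_tensorMap (N : GrMod k m ∅) (h : σ ⊆ τ) (h' : τ ⊆ υ)
    (z : locRing k m σ ⊗[locRing k m ∅] N) :
    tensorMap N h' (tensorMap N h z) = tensorMap N (Finset.Subset.trans h h') z := by
  induction z using TensorProduct.induction_on with
  | zero => simp only [map_zero]
  | add y z hy hz => simp only [map_add, hy, hz]
  | tmul r x => simp only [tensorMap_tmul, incl_incl]

/-- The `K`-localization `L_K(N)` of a finitely generated graded `R`-module `N`. -/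
def LocMod.localization (K : LowerSet (Finset (Fin m))) (N : GrMod k m ∅) : LocMod k K where
  obj := fun σ _ => N.localize σ
  map := fun _ _ h => tensorMap N h
  map_mem := fun _ _ h => tensorMap_mem N h
  inducesIso := fun _ _ h => tensorMap_inducesIso N h
  map_id := fun _ => tensorMap_refl N _
  map_comp := fun _ _ _ h h' => tensorMap_tensorMap N h h'

end Localization

/-! ### Quadrants, torsion-free objects and the complexes `K_m` -/

section Main

variable {k : Type u} [Field k] {m : ℕ}

/-- The quadrant `[a, ∞)`, with `[a, ∞)_σ = t^a R_σ` and transition maps the inclusions. Here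
`t^a R_σ` is written as the free module on a generator of multidegree `a`. For `σ = [m] ∖ {i}` it is
`t_i^{a_i} R_σ`, since the other variables are invertible in `R_σ`. -/
def LocMod.quadrant (k : Type u) [Field k] {m : ℕ} (K : LowerSet (Finset (Fin m)))
    (a : Fin m → ℕ) : LocMod k K where
  obj := fun σ _ => GrMod.shift k σ a
  map := fun {σ τ} _ _ h =>
    ({ toFun := incl k h
       map_add' := map_add _
       map_smul' := map_mul _ } : locRing k m σ →ₛₗ[incl k h] locRing k m τ)
  map_mem := by
    intro σ τ _ _ h d r hr g hg
    obtain ⟨g', rfl, hg'⟩ := exists_of_coeff_incl_ne_zero h _ g hg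
    exact hr g' hg'
  inducesIso := fun _ _ h => InducesIso.ringHom (incl k h) _ fun _ => rfl
  map_id := fun {σ} _ r => incl_refl (Finset.Subset.refl σ) r
  map_comp := fun _ _ _ h h' r => incl_incl h h' r

/-- The complex `K_m`, the `(m - 3)`-skeleton of the simplex `Δ^{m - 1}`: its faces are the subsets
of `[m]` with at most `m - 2` elements. -/
def codimTwoSkeleton (m : ℕ) : LowerSet (Finset (Fin m)) where
  carrier := {σ | σ.card + 2 ≤ m}
  lower' := fun _ _ h hσ => (Nat.add_le_add_right (Finset.card_le_card h) 2).trans hσ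

theorem mem_codimTwoSkeleton {σ : Finset (Fin m)} : σ ∈ codimTwoSkeleton m ↔ σ.card + 2 ≤ m :=
  Iff.rfl

theorem univ_notMem : (Finset.univ : Finset (Fin m)) ∉ codimTwoSkeleton m := by
  rw [mem_codimTwoSkeleton, Finset.card_univ, Fintype.card_fin]
  omega

theorem erase_notMem (i : Fin m) :
    (Finset.univ.erase i : Finset (Fin m)) ∉ codimTwoSkeleton m := by
  rw [mem_codimTwoSkeleton, Finset.card_erase_of_mem (Finset.mem_univ i), Finset.card_univ,
    Fintype.card_fin]
  omega

namespace LocMod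

/-- The torsion-free class: for each `i`, with `σ_i = [m] ∖ {i}`, the `R_{σ_i}`-module `M_{σ_i}` has
no nonzero element annihilated by a power of `t_i`. -/
def IsTorsionFree (M : LocMod k (codimTwoSkeleton m)) : Prop :=
  ∀ (i : Fin m) (x : M.obj (Finset.univ.erase i) (erase_notMem i)),
    (∃ n : ℕ, var k (Finset.univ.erase i) i ^ n • x = 0) → x = 0

/-- The object `M` is isomorphic to a finite direct sum of quadrants. -/
def IsSumOfQuadrants {K : LowerSet (Finset (Fin m))} (M : LocMod k K) : Prop :=
  ∃ (n : ℕ) (a : Fin n → Fin m → ℕ), Nonempty (M ≅ ⨁ fun j => quadrant k K (a j))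

end LocMod

/-- The graded `R`-module `R⟨w, y, z | t_1 w = t_3 y - t_2 z⟩` in `m ≥ 3` variables, with generators
in multidegrees `|w| = e_2 + e_3`, `|y| = e_1 + e_2` and `|z| = e_1 + e_3`: the quotient of the free
module on `w, y, z` by the submodule generated by `t_1 w - t_3 y + t_2 z`. The variables
`t_1, t_2, t_3` have indices `0, 1, 2`. -/
def threeGenModule (k : Type u) [Field k] {m : ℕ} (hm : 3 ≤ m) : GrMod k m ∅ :=
  let i₁ : Fin m := ⟨0, by omega⟩
  let i₂ : Fin m := ⟨1, by omega⟩
  let i₃ : Fin m := ⟨2, by omega⟩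
  let e : Fin m → Fin m → ℕ := fun i => Pi.single i 1
  let F : GrMod k m ∅ := (GrMod.shift k ∅ (e i₂ + e i₃)).prod
    ((GrMod.shift k ∅ (e i₁ + e i₂)).prod (GrMod.shift k ∅ (e i₁ + e i₃)))
  let rel : locRing k m ∅ × locRing k m ∅ × locRing k m ∅ := (var k ∅ i₁, -var k ∅ i₃, var k ∅ i₂)
  F.quotient {rel} (by
    rintro _ rfl
    refine ⟨fun i => ((e i₁ + e i₂ + e i₃) i : ℕ), ?_, Submodule.neg_mem _ ?_, ?_⟩ <;>
    · refine var_mem_shift _ _ _ ?_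
      ext i
      simp only [Pi.add_apply]
      push_cast
      ring)

end Main

end

end PersLoc

/-!
An object `M` of `𝒟(K_m)` has only the modules `M_{[m]}` and `M_{[m] ∖ {i}}`. The multidegree-zero
part `V` of `M_{[m]}` is a vector space, and `M_{[m]}` is recovered from it by multiplying with
Laurent monomials. If `M` is torsion-free, then `M_{[m] ∖ {i}}` embeds in its localization
`M_{[m]}`, so that `M` amounts to `V` with `m` exhaustive filtrations by `ℕ`: the `n`-th step of
the `i`-th one consists of the `v` for which `t_i ^ n v` comes from `M_{[m] ∖ {i}}`. A quadrant
`[a, ∞)` is a line whose `i`-th filtration jumps at `a_i`, and `M` is a finite direct sum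
of quadrants as soon as `V` has a basis adapted to all `m` filtrations
(`LocMod.isSumOfQuadrants_of_basis`).

For `m = 2` such a basis always exists, since any two filtrations of a vector space have a common
adapted basis (`exists_basis_adapted`).

For `m ≥ 3` the three-generator module has a plane for `V`, and its first three filtrations begin
with three different lines, spanned by the translates of `w`, `z` and `y`
(`LocMod.exists_appAt_locGen`). An endomorphism scales each of these lines, and since the spanning
vectors satisfy `w = y - z` the three factors agree; so every endomorphism is a scalar
(`LocMod.exists_appAt_eq_smul`). Hence the only idempotents are `0` and `1`, which makes the object
indecomposable. If it were a direct sum of quadrants, then one of the idempotents given by the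
summands would be the identity, and the object would be a retract of a quadrant, although it has
rank two.
-/

namespace PersLoc

noncomputable section

/-! ### Monomials and graded maps -/

section Monomials

variable {k : Type u} [Field k] {m : ℕ} {σ τ : Finset (Fin m)}

/-- The Laurent monomial `t^g` in `R_σ`. -/
abbrev monomial (k : Type u) [Field k] {m : ℕ} {σ : Finset (Fin m)} (g : mon m σ) :
    locRing k m σ :=
  AddMonoidAlgebra.single g 1

/-- Every integer vector is an exponent of the Laurent polynomial ring `R_{[m]}`. -/
def laurentExp {m : ℕ} (d : Fin m → ℤ) : mon m Finset.univ :=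
  ⟨d, fun i hi => absurd (Finset.mem_univ i) hi⟩

@[simp]
theorem coe_laurentExp (d : Fin m → ℤ) : (laurentExp d : Fin m → ℤ) = d := rfl

theorem monomial_mul (g h : mon m σ) :
    monomial k g * monomial k h = monomial k (g + h) := by
  rw [AddMonoidAlgebra.single_mul_single, one_mul]

theorem monomial_zero : monomial k (0 : mon m σ) = 1 := rfl

theorem incl_monomial (h : σ ⊆ τ) (g : mon m σ) :
    incl k h (monomial k g) = monomial k (AddSubmonoid.inclusion (mon_mono h) g) :=
  incl_single h g 1

theorem incl_monomial_univ (h : σ ⊆ Finset.univ) (g : mon m σ) :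
    incl k h (monomial k g) = monomial k (laurentExp g) :=
  incl_single h g 1

theorem incl_injective (h : σ ⊆ τ) : Function.Injective (incl k h) :=
  AddMonoidAlgebra.mapDomain_injective
    (AddSubmonoid.inclusion_injective (mon_mono h))

theorem monomial_smul_neg {U : Type u} [AddCommGroup U] [Module (locRing k m Finset.univ) U]
    (d : Fin m → ℤ) (x : U) :
    monomial k (laurentExp d) • monomial k (laurentExp (-d)) • x = x := by
  rw [smul_smul, monomial_mul]
  have : laurentExp d + laurentExp (-d) = 0 := Subtype.ext (add_neg_cancel d)
  rw [this, monomial_zero, one_smul]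

theorem monomial_smul_injective {U : Type u} [AddCommGroup U]
    [Module (locRing k m Finset.univ) U] (d : Fin m → ℤ) :
    Function.Injective fun x : U => monomial k (laurentExp d) • x := fun x y h => by
  have := congrArg (fun z => monomial k (laurentExp (-d)) • z) h
  have key := fun x : U => monomial_smul_neg (k := k) (-d) x
  simp only [neg_neg] at key
  simpa only [key] using this

theorem GrMod.monomial_smul_mem (M : GrMod k m σ) (g : mon m σ) {d e : Fin m → ℤ} {x : M}
    (hx : x ∈ M.deg d) (h : (g : Fin m → ℤ) + d = e) : monomial k g • x ∈ M.deg e :=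
  h ▸ M.smul_mem g d x hx

theorem GrMod.proj_eq_self_iff (M : GrMod k m σ) (d : Fin m → ℤ) (x : M) :
    M.proj d x = x ↔ x ∈ M.deg d :=
  ⟨fun h => h ▸ M.proj_mem d x, fun h => by rw [M.proj_of_mem h, if_pos rfl]⟩

/-- A degree-preserving additive map commutes with the projections to the graded parts. -/
theorem GrMod.map_proj (M : GrMod k m σ) (N : GrMod k m τ) (f : M →+ N)
    (hf : ∀ d, ∀ x ∈ M.deg d, f x ∈ N.deg d) (d : Fin m → ℤ) (x : M) :
    f (M.proj d x) = N.proj d (f x) := by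
  refine Submodule.iSup_induction M.deg
    (motive := fun x => f (M.proj d x) = N.proj d (f x)) (M.mem_iSup x) ?_ ?_ ?_
  · intro e y hy
    rw [M.proj_of_mem hy, N.proj_of_mem (hf e y hy)]
    split_ifs
    · rfl
    · exact map_zero f
  · simp only [map_zero]
  · intro y z hy hz
    simp only [map_add, hy, hz]

theorem GrMod.map_smul_base (M : GrMod k m σ) (N : GrMod k m τ) (h : σ ⊆ τ)
    (f : M →ₛₗ[incl k h] N) (c : k) (x : M) : f (c • x) = c • f x := by
  rw [← algebraMap_smul (locRing k m σ) c x, map_smulₛₗ,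
    ← algebraMap_smul (locRing k m τ) c (f x)]
  congr 1
  exact incl_single _ _ _

/-- A homogeneous element of `t^a R_σ` is a scalar multiple of a monomial. -/
theorem mem_deg_shift {a : Fin m → ℕ} {d : Fin m → ℤ} {r : locRing k m σ}
    (hr : r ∈ (GrMod.shift k σ a).deg d) :
    r = 0 ∨ ∃ (g : mon m σ) (c : k), (g : Fin m → ℤ) + (natMon σ a : Fin m → ℤ) = d ∧
      r = AddMonoidAlgebra.single g c := by
  by_cases h0 : r = 0
  · exact Or.inl h0
  · right
    have hr' : ∀ g : mon m σ, r.coeff g ≠ 0 → (g + natMon σ a : Fin m → ℤ) = d := hr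
    obtain ⟨g, hg⟩ : ∃ g, r.coeff g ≠ 0 := by
      by_contra hne
      push Not at hne
      exact h0 (by ext g; exact hne g)
    refine ⟨g, r.coeff g, hr' g hg, ?_⟩
    ext g'
    rw [AddMonoidAlgebra.coeff_single, Finsupp.single_apply]
    split_ifs with hgg
    · rw [hgg]
    · by_contra hg'
      exact hgg (Subtype.ext (add_right_cancel ((hr' g hg).trans (hr' g' hg').symm)))

/-- In degree `d`, multiplying a degree-zero element by a Laurent polynomial only sees the
coefficient of `t^d`. -/
theorem GrMod.proj_smul_of_mem_zero (U : GrMod k m Finset.univ) {v : U} (hv : v ∈ U.deg 0)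
    (d : Fin m → ℤ) (r : locRing k m Finset.univ) :
    U.proj d (r • v) = monomial k (laurentExp d) • r.coeff (laurentExp d) • v := by
  induction r using AddMonoidAlgebra.induction_linear with
  | zero => simp
  | add f g hf hg => rw [add_smul, map_add, hf, hg, AddMonoidAlgebra.coeff_add, Finsupp.add_apply,
      add_smul, smul_add]
  | single g c =>
    rw [U.proj_of_mem (U.single_smul_mem g c hv), AddMonoidAlgebra.coeff_single,
      Finsupp.single_apply, add_zero]
    by_cases h : (g : Fin m → ℤ) = d
    · have h' : g = laurentExp d := Subtype.ext h
      rw [if_pos h, if_pos h', single_smul_eq, h', smul_comm]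
    · have h' : g ≠ laurentExp d := fun h' => h (congrArg Subtype.val h')
      rw [if_neg h, if_neg h', zero_smul, smul_zero]

theorem GrMod.linearIndependent_of_mem_zero {ι : Type u} (U : GrMod k m Finset.univ) {v : ι → U}
    (hv : ∀ j, v j ∈ U.deg 0) (hli : LinearIndependent k v) :
    LinearIndependent (locRing k m Finset.univ) v := by
  rw [linearIndependent_iff'] at hli ⊢
  intro s r hr j hj
  ext g
  obtain ⟨d, rfl⟩ : ∃ d, g = laurentExp d := ⟨g, rfl⟩
  refine hli s (fun i => (r i).coeff (laurentExp d)) ?_ j hj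
  apply monomial_smul_injective (k := k) d
  have := congrArg (U.proj d) hr
  rw [map_sum, map_zero] at this
  simp only [GrMod.proj_smul_of_mem_zero U (hv _)] at this
  simpa only [Finset.smul_sum, smul_zero] using this

end Monomials

/-! ### Isomorphisms and direct sums of localized persistence modules -/

namespace LocMod

variable {k : Type u} [Field k] {m : ℕ} {K : LowerSet (Finset (Fin m))}

theorem isIso_of_bijective {M N : LocMod k K} (f : M ⟶ N)
    (h : ∀ σ hσ, Function.Bijective (Hom.app f σ hσ)) : IsIso f := by
  let e := fun σ hσ => LinearEquiv.ofBijective (Hom.app f σ hσ) (h σ hσ)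
  have he : ∀ σ hσ x, Hom.app f σ hσ ((e σ hσ).symm x) = x := fun σ hσ x =>
    (e σ hσ).apply_symm_apply x
  have he' : ∀ σ hσ x, (e σ hσ).symm (Hom.app f σ hσ x) = x := fun σ hσ x =>
    (e σ hσ).symm_apply_apply x
  let g : N ⟶ M :=
    { app := fun σ hσ => (e σ hσ).symm.toLinearMap
      app_mem := fun σ hσ d x hx => by
        change (e σ hσ).symm x ∈ _
        rw [← GrMod.proj_eq_self_iff]
        apply (h σ hσ).1
        have := GrMod.map_proj (M.obj σ hσ) (N.obj σ hσ) (Hom.app f σ hσ).toAddMonoidHom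
          (Hom.app_mem f σ hσ) d ((e σ hσ).symm x)
        simp only [LinearMap.toAddMonoidHom_coe, he] at this
        rw [this, he, GrMod.proj_eq_self_iff]
        exact hx
      naturality := fun {σ τ} hσ hτ hl x => by
        change (e τ hτ).symm _ = M.map hσ hτ hl ((e σ hσ).symm x)
        apply (h τ hτ).1
        rw [he, Hom.naturality, he] }
  exact ⟨g, hom_ext fun σ hσ x => he' σ hσ x, hom_ext fun σ hσ x => he σ hσ x⟩

theorem sum_app {M N : LocMod k K} {J : Type*} (s : Finset J) (f : J → (M ⟶ N))
    (σ : Finset (Fin m)) (hσ : σ ∉ K) (x : M.obj σ hσ) :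
    Hom.app (∑ j ∈ s, f j : M ⟶ N) σ hσ x = ∑ j ∈ s, Hom.app (f j) σ hσ x := by
  classical
  induction s using Finset.induction_on with
  | empty => rfl
  | insert a s ha ih => rw [Finset.sum_insert ha, Finset.sum_insert ha, add_app,
      LinearMap.add_apply, ih]

/-- A finite family of maps into `M` which is pointwise a direct sum decomposition identifies `M`
with the biproduct. -/
theorem isIso_desc {M : LocMod k K} {n : ℕ} {Q : Fin n → LocMod k K} (f : ∀ j, Q j ⟶ M)
    (hinj : ∀ σ hσ (q : ∀ j, (Q j).obj σ hσ), ∑ j, Hom.app (f j) σ hσ (q j) = 0 → q = 0)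
    (hsurj : ∀ σ hσ (x : M.obj σ hσ), ∃ q : ∀ j, (Q j).obj σ hσ,
      ∑ j, Hom.app (f j) σ hσ (q j) = x) :
    IsIso (biproduct.desc f) := by
  have hdesc : ∀ σ hσ (x : (⨁ Q).obj σ hσ), Hom.app (biproduct.desc f) σ hσ x =
      ∑ j, Hom.app (f j) σ hσ (Hom.app (biproduct.π Q j) σ hσ x) := by
    intro σ hσ x
    rw [biproduct.desc_eq, sum_app]
    rfl
  have hι : ∀ σ hσ j (x : (Q j).obj σ hσ), Hom.app (biproduct.desc f) σ hσ
      (Hom.app (biproduct.ι Q j) σ hσ x) = Hom.app (f j) σ hσ x := by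
    intro σ hσ j x
    conv_rhs => rw [← biproduct.ι_desc f j]
    rfl
  refine isIso_of_bijective _ fun σ hσ => ⟨?_, ?_⟩
  · rw [injective_iff_map_eq_zero]
    intro x hx
    rw [hdesc] at hx
    have h0 := hinj σ hσ _ hx
    have htot := congrArg (fun g => Hom.app g σ hσ x) (biproduct.total (f := Q))
    simp only [sum_app, comp_app, LinearMap.comp_apply, id_app, LinearMap.id_apply] at htot
    rw [← htot]
    refine Finset.sum_eq_zero fun j _ => ?_
    rw [show Hom.app (biproduct.π Q j) σ hσ x = 0 from congrFun h0 j, map_zero]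
  · intro x
    obtain ⟨q, rfl⟩ := hsurj σ hσ x
    refine ⟨∑ j, Hom.app (biproduct.ι Q j) σ hσ (q j), ?_⟩
    rw [map_sum]
    exact Finset.sum_congr rfl fun j _ => hι σ hσ j _

/-- The map from the quadrant `[a, ∞)` given by a compatible family of elements of degree `a`. -/
def quadrantHom (M : LocMod k K) (a : Fin m → ℕ) (x : ∀ σ hσ, M.obj σ hσ)
    (hx : ∀ σ hσ, x σ hσ ∈ (M.obj σ hσ).deg fun i => (a i : ℤ))
    (hmap : ∀ {σ τ} (hσ : σ ∉ K) (hτ : τ ∉ K) (h : σ ⊆ τ), M.map hσ hτ h (x σ hσ) = x τ hτ) :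
    quadrant k K a ⟶ M where
  app := fun σ hσ => LinearMap.toSpanSingleton (locRing k m σ) _ (x σ hσ)
  app_mem := fun σ hσ d r hr => by
    rcases mem_deg_shift hr with rfl | ⟨g, c, rfl, rfl⟩
    · exact (map_zero (LinearMap.toSpanSingleton (locRing k m σ) _ (x σ hσ))).symm ▸
        Submodule.zero_mem _
    · exact (M.obj σ hσ).single_smul_mem g c (hx σ hσ)
  naturality := fun {σ τ} hσ hτ h (r : locRing k m σ) => by
    change incl k h r • x τ hτ = M.map hσ hτ h (r • x σ hσ)
    rw [map_smulₛₗ, hmap]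

/-! ### The filtrations of the generic fibre -/

/-- The part of `M_{[m]}` in multidegree `0`. -/
abbrev fibre (M : LocMod k K) (hu : Finset.univ ∉ K) : Submodule k (M.obj Finset.univ hu) :=
  (M.obj Finset.univ hu).deg 0

/-- The subspace of the generic fibre of those `v` for which `t^d v` comes from `M_σ` in
multidegree `d`. -/
def fibreFiltration (M : LocMod k K) (hu : Finset.univ ∉ K) (σ : Finset (Fin m)) (hσ : σ ∉ K)
    (d : Fin m → ℤ) : Submodule k (M.fibre hu) where
  carrier := {v | ∃ x ∈ (M.obj σ hσ).deg d,
    M.map hσ hu (Finset.subset_univ σ) x = monomial k (laurentExp d) • (v : M.obj Finset.univ hu)}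
  zero_mem' := ⟨0, Submodule.zero_mem _, by rw [map_zero, Submodule.coe_zero, smul_zero]⟩
  add_mem' := by
    rintro v w ⟨x, hx, hxv⟩ ⟨y, hy, hyw⟩
    exact ⟨x + y, Submodule.add_mem _ hx hy, by rw [map_add, hxv, hyw, Submodule.coe_add, smul_add]⟩
  smul_mem' := by
    rintro c v ⟨x, hx, hxv⟩
    refine ⟨c • x, Submodule.smul_mem _ c hx, ?_⟩
    rw [GrMod.map_smul_base, hxv, Submodule.coe_smul, smul_comm]

theorem fibreFiltration_mono (M : LocMod k K) (hu : Finset.univ ∉ K) {σ : Finset (Fin m)}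
    (hσ : σ ∉ K) {d e : Fin m → ℤ} (h : e - d ∈ mon m σ) :
    M.fibreFiltration hu σ hσ d ≤ M.fibreFiltration hu σ hσ e := by
  rintro v ⟨x, hx, hxv⟩
  refine ⟨monomial k (⟨e - d, h⟩ : mon m σ) • x,
    (M.obj σ hσ).monomial_smul_mem _ hx (sub_add_cancel e d), ?_⟩
  rw [map_smulₛₗ, hxv, incl_monomial_univ, smul_smul, monomial_mul]
  congr 2
  exact Subtype.ext (sub_add_cancel e d)

/-- An object with injective maps to `M_{[m]}` whose generic fibre has a basis adapted to all the
filtrations is a finite direct sum of quadrants. The basis is automatically finite, since it is also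
a basis of the finitely generated module `M_{[m]}` over the nontrivial ring `R_{[m]}`. -/
theorem isSumOfQuadrants_of_basis (M : LocMod k K) (hu : Finset.univ ∉ K)
    (hinj : ∀ σ hσ, Function.Injective (M.map hσ hu (Finset.subset_univ σ)))
    {ι : Type u} (b : Module.Basis ι k (M.fibre hu)) (a : ι → Fin m → ℕ)
    (hmem : ∀ σ hσ j, b j ∈ M.fibreFiltration hu σ hσ fun i => (a j i : ℤ))
    (hspan : ∀ σ hσ d, M.fibreFiltration hu σ hσ d ≤
      Submodule.span k (b '' {j | (d - fun i => (a j i : ℤ)) ∈ mon m σ})) :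
    M.IsSumOfQuadrants := by
  -- `x σ _ j` is the element of `M_σ` of degree `a j` lying over `t^{a j} b j`; these
  -- elements turn out to form an `R_σ`-basis of `M_σ`
  choose x hx hxb using hmem
  -- `R_{[m]}`-linear independence of the basis of the fibre, also after shifting by monomials
  have hli0 : LinearIndependent (locRing k m Finset.univ)
      (fun j => (b j : M.obj Finset.univ hu)) :=
    GrMod.linearIndependent_of_mem_zero _ (fun j => (b j).2)
      (b.linearIndependent.map' (M.fibre hu).subtype (Submodule.ker_subtype _))
  have hli1 : ∀ (s : Finset ι) (r : ι → locRing k m Finset.univ),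
      ∑ j ∈ s, r j • monomial k (laurentExp fun i => (a j i : ℤ)) •
        (b j : M.obj Finset.univ hu) = 0 → ∀ j ∈ s, r j = 0 := by
    intro s r hr j hj
    simp only [smul_smul] at hr
    have h0 := linearIndependent_iff'.1 hli0 s _ hr j hj
    have h1 := monomial_smul_neg (k := k) (fun i => (a j i : ℤ)) (r j)
    rw [smul_eq_mul, smul_eq_mul, mul_left_comm, mul_comm _ (r j), h0, mul_zero] at h1
    exact h1.symm
  have hli : ∀ σ hσ, LinearIndependent (locRing k m σ) (x σ hσ) := by
    intro σ hσ
    rw [linearIndependent_iff']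
    intro s r hr j hj
    apply incl_injective (k := k) (Finset.subset_univ σ)
    rw [map_zero]
    refine hli1 s (fun j => incl k (Finset.subset_univ σ) (r j)) ?_ j hj
    have := congrArg (M.map hσ hu (Finset.subset_univ σ)) hr
    rw [map_sum, map_zero] at this
    simpa only [map_smulₛₗ, hxb] using this
  -- `t^d b j` lifts to the span of the `x σ _ j` as soon as `d - a j` is an exponent of `R_σ`
  have hlift : ∀ σ hσ (d : Fin m → ℤ), ∀ v ∈ Submodule.span k
      (b '' {j | (d - fun i => (a j i : ℤ)) ∈ mon m σ}),
      ∃ z ∈ Submodule.span (locRing k m σ) (Set.range (x σ hσ)),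
        M.map hσ hu (Finset.subset_univ σ) z =
          monomial k (laurentExp d) • (v : M.obj Finset.univ hu) := by
    intro σ hσ d v hv
    induction hv using Submodule.span_induction with
    | mem v hv =>
      obtain ⟨j, hj, rfl⟩ := hv
      refine ⟨monomial k (⟨_, hj⟩ : mon m σ) • x σ hσ j,
        Submodule.smul_mem _ _ (Submodule.subset_span ⟨j, rfl⟩), ?_⟩
      rw [map_smulₛₗ, hxb, incl_monomial_univ, smul_smul, monomial_mul]
      congr 2
      exact Subtype.ext (sub_add_cancel d _)
    | zero => exact ⟨0, Submodule.zero_mem _, by rw [map_zero, Submodule.coe_zero, smul_zero]⟩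
    | add v w _ _ hv hw =>
      obtain ⟨y, hy, hyv⟩ := hv
      obtain ⟨z, hz, hzw⟩ := hw
      exact ⟨y + z, Submodule.add_mem _ hy hz,
        by rw [map_add, hyv, hzw, Submodule.coe_add, smul_add]⟩
    | smul c v _ hv =>
      obtain ⟨y, hy, hyv⟩ := hv
      refine ⟨c • y, ?_, by rw [GrMod.map_smul_base, hyv, Submodule.coe_smul, smul_comm]⟩
      rw [← algebraMap_smul (locRing k m σ) c y]
      exact Submodule.smul_mem _ _ hy
  have htop : ∀ σ hσ, ⊤ ≤ Submodule.span (locRing k m σ) (Set.range (x σ hσ)) := by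
    intro σ hσ y _
    refine Submodule.iSup_induction (M.obj σ hσ).deg
      (motive := fun y => y ∈ Submodule.span (locRing k m σ) (Set.range (x σ hσ)))
      ((M.obj σ hσ).mem_iSup y) ?_ (Submodule.zero_mem _) (fun _ _ => Submodule.add_mem _)
    intro d y hy
    have hv : monomial k (laurentExp (-d)) • M.map hσ hu (Finset.subset_univ σ) y ∈ M.fibre hu :=
      GrMod.monomial_smul_mem _ _ (M.map_mem _ _ _ d y hy) (neg_add_cancel d)
    have hdv := monomial_smul_neg (k := k) d (M.map hσ hu (Finset.subset_univ σ) y)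
    obtain ⟨z, hz, hzy⟩ := hlift σ hσ d ⟨_, hv⟩ (hspan σ hσ d ⟨y, hy, hdv.symm⟩)
    rw [hdv] at hzy
    rwa [← hinj σ hσ hzy]
  let B := fun σ hσ => Module.Basis.mk (hli σ hσ) (htop σ hσ)
  have hBx : ∀ σ hσ j, B σ hσ j = x σ hσ j := fun σ hσ j => Module.Basis.mk_apply _ _ j
  have : Finite ι := Module.Finite.finite_basis (B Finset.univ hu)
  obtain ⟨n, ⟨e⟩⟩ := Finite.exists_equiv_fin ι
  let f : ∀ j : Fin n, quadrant k K (a (e.symm j)) ⟶ M := fun j =>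
    quadrantHom M _ (fun σ hσ => x σ hσ (e.symm j)) (fun σ hσ => hx σ hσ _) (by
      intro σ τ hσ hτ h
      apply hinj τ hτ
      rw [M.map_comp, hxb, hxb])
  have hf : ∀ j σ hσ (r : locRing k m σ),
      Hom.app (f j) σ hσ r = r • x σ hσ (e.symm j) :=
    fun _ _ _ _ => rfl
  have hiso : IsIso (biproduct.desc f) := by
    refine isIso_desc f ?_ ?_
    · intro σ hσ (q : Fin n → locRing k m σ) hq
      have hli' := (hli σ hσ).comp e.symm e.symm.injective
      exact funext (Fintype.linearIndependent_iff.1 hli' q hq)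
    · intro σ hσ y
      refine ⟨fun j => (((B σ hσ).reindex e).repr y j : locRing k m σ), ?_⟩
      simp only [hf, ← hBx]
      have := ((B σ hσ).reindex e).sum_repr y
      simpa only [Module.Basis.reindex_apply] using this
  exact ⟨n, fun j => a (e.symm j), ⟨(asIso (biproduct.desc f)).symm⟩⟩

end LocMod

/-! ### Bases adapted to two filtrations -/

section Filtrations

variable {k V : Type u} [Field k] [AddCommGroup V] [Module k V]

/-- Two exhaustive filtrations of a vector space by `ℕ` have a common adapted basis. The step
`(a, b)` contributes a complement in `F a ⊓ G b` of the span of the smaller steps; independence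
follows by looking at the lexicographically largest step with a nonzero contribution and using the
modular law. -/
theorem exists_basis_adapted (F G : ℕ → Submodule k V) (hF : Monotone F) (hG : Monotone G)
    (hF' : ∀ v, ∃ n, v ∈ F n) (hG' : ∀ v, ∃ n, v ∈ G n) :
    ∃ (ι : Type u) (b : Module.Basis ι k V) (p q : ι → ℕ),
      (∀ j, b j ∈ F (p j)) ∧ (∀ j, b j ∈ G (q j)) ∧
      (∀ n, F n ≤ Submodule.span k (b '' {j | p j ≤ n})) ∧
      (∀ n, G n ≤ Submodule.span k (b '' {j | q j ≤ n})) := by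
  let F' : ℕ → Submodule k V := fun a => ⨆ (a' : ℕ) (_ : a' < a), F a'
  let G' : ℕ → Submodule k V := fun b => ⨆ (b' : ℕ) (_ : b' < b), G b'
  have hF'F : ∀ a, F' a ≤ F a := fun a => iSup₂_le fun a' h => hF h.le
  have hG'G : ∀ b, G' b ≤ G b := fun b => iSup₂_le fun b' h => hG h.le
  let H' : ℕ × ℕ → Submodule k V := fun s => (F' s.1 ⊓ G s.2) ⊔ (F s.1 ⊓ G' s.2)
  have hH' : ∀ s, H' s ≤ F s.1 ⊓ G s.2 := fun s =>
    sup_le (inf_le_inf_right _ (hF'F _)) (inf_le_inf_left _ (hG'G _))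
  have hC : ∀ s, ∃ C : Submodule k V, C ≤ F s.1 ⊓ G s.2 ∧ Disjoint (H' s) C ∧
      H' s ⊔ C = F s.1 ⊓ G s.2 := by
    intro s
    obtain ⟨C, hC⟩ := Submodule.exists_isCompl (H' s)
    refine ⟨C ⊓ (F s.1 ⊓ G s.2), inf_le_right, hC.disjoint.mono_right inf_le_left, ?_⟩
    rw [← sup_inf_assoc_of_le C (hH' s), hC.sup_eq_top, top_inf_eq]
  choose C hCle hCdisj hCsup using hC
  have hF'mono : ∀ {a' a : ℕ}, a' < a → F a' ≤ F' a := fun {a' a} h => le_iSup₂_of_le a' h le_rfl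
  have hG'mono : ∀ {a' a : ℕ}, a' < a → G a' ≤ G' a := fun {a' a} h => le_iSup₂_of_le a' h le_rfl
  have hind : iSupIndep C := by
    classical
    rw [iSupIndep_iff_finsetSum_eq_zero_imp_eq_zero]
    intro s c hc h0
    by_contra hne
    push Not at hne
    obtain ⟨i, his, hi0⟩ := hne
    -- the lexicographically largest index with a nonzero summand
    obtain ⟨t, ht, htmax⟩ := (s.filter fun i => c i ≠ 0).exists_max_image
      (fun i => toLex i) ⟨i, Finset.mem_filter.2 ⟨his, hi0⟩⟩
    obtain ⟨hts, ht0⟩ := Finset.mem_filter.1 ht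
    have hrest : ∀ i ∈ s.erase t, c i ∈ F' t.1 ⊔ (F t.1 ⊓ G' t.2) := by
      intro i hi
      obtain ⟨hit, his⟩ := Finset.mem_erase.1 hi
      by_cases hi0 : c i = 0
      · rw [hi0]
        exact Submodule.zero_mem _
      have hci := hCle i (hc i his)
      have hle := htmax i (Finset.mem_filter.2 ⟨his, hi0⟩)
      rcases Prod.Lex.toLex_le_toLex.1 hle with h | ⟨h1, h2⟩
      · exact Submodule.mem_sup_left (hF'mono h hci.1)
      · have h2' : i.2 < t.2 := lt_of_le_of_ne h2 fun h => hit (Prod.ext h1 h)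
        exact Submodule.mem_sup_right ⟨h1 ▸ hci.1, hG'mono h2' hci.2⟩
    have hct := hCle t (hc t hts)
    have hct' : c t ∈ F' t.1 ⊔ (F t.1 ⊓ G' t.2) := by
      rw [← Finset.add_sum_erase s c hts] at h0
      rw [eq_neg_of_add_eq_zero_left h0]
      exact Submodule.neg_mem _ (Submodule.sum_mem _ hrest)
    have hctH : c t ∈ H' t := by
      have : (F' t.1 ⊔ (F t.1 ⊓ G' t.2)) ⊓ G t.2 ≤ H' t := by
        rw [sup_comm, sup_inf_assoc_of_le _ (inf_le_right.trans (hG'G _)), sup_comm]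
      exact this ⟨hct', hct.2⟩
    exact ht0 ((Submodule.disjoint_def.1 (hCdisj t)) _ hctH (hc t hts))
  have hle : ∀ a b, F a ⊓ G b ≤ ⨆ (s : ℕ × ℕ) (_ : s.1 ≤ a ∧ s.2 ≤ b), C s := by
    have hmono : ∀ {a b a' b' : ℕ}, a' ≤ a → b' ≤ b →
        (⨆ (s : ℕ × ℕ) (_ : s.1 ≤ a' ∧ s.2 ≤ b'), C s) ≤
          ⨆ (s : ℕ × ℕ) (_ : s.1 ≤ a ∧ s.2 ≤ b), C s := fun ha hb =>
      iSup₂_le fun s hs => le_iSup₂_of_le s ⟨hs.1.trans ha, hs.2.trans hb⟩ le_rfl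
    -- the predecessor step of a filtration is either zero or again a member of it
    have hpred : ∀ (E : ℕ → Submodule k V), Monotone E → ∀ a,
        (⨆ (a' : ℕ) (_ : a' < a), E a') = ⊥ ∨
          ∃ a' < a, (⨆ (a' : ℕ) (_ : a' < a), E a') ≤ E a' := by
      intro E hE a
      cases a with
      | zero => exact Or.inl (by simp)
      | succ a => exact Or.inr ⟨a, a.lt_succ_self, iSup₂_le fun a' h => hE (Nat.le_of_lt_succ h)⟩
    intro a
    induction a using Nat.strong_induction_on with
    | _ a iha =>
      intro b
      induction b using Nat.strong_induction_on with
      | _ b ihb =>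
        rw [← hCsup (a, b)]
        refine sup_le (sup_le ?_ ?_) (le_iSup₂_of_le (a, b) ⟨le_rfl, le_rfl⟩ le_rfl)
        · rcases hpred F hF a with h | ⟨a', ha', h⟩
          · change F' a ⊓ G b ≤ _
            rw [show F' a = ⊥ from h, bot_inf_eq]
            exact bot_le
          · exact (inf_le_inf_right _ h).trans ((iha a' ha' b).trans (hmono ha'.le le_rfl))
        · rcases hpred G hG b with h | ⟨b', hb', h⟩
          · change F a ⊓ G' b ≤ _
            rw [show G' b = ⊥ from h, inf_bot_eq]
            exact bot_le
          · exact (inf_le_inf_left _ h).trans ((ihb b' hb').trans (hmono le_rfl hb'.le))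
  have htop : iSup C = ⊤ := by
    refine eq_top_iff.2 fun v _ => ?_
    obtain ⟨a, ha⟩ := hF' v
    obtain ⟨b, hb⟩ := hG' v
    exact (iSup₂_le fun s _ => le_iSup C s) (hle a b ⟨ha, hb⟩)
  have hint := DirectSum.isInternal_submodule_of_iSupIndep_of_iSup_eq_top hind htop
  let β := fun s => Module.Basis.ofVectorSpace k (C s)
  let B := hint.collectedBasis β
  have hB : ∀ j, B j = (β j.1 j.2 : V) := fun j => by
    rw [DirectSum.IsInternal.collectedBasis_coe]
  have hBC : ∀ j, B j ∈ C j.1 := fun j => hB j ▸ (β j.1 j.2).2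
  have hCspan : ∀ s, C s ≤ Submodule.span k (B '' {j | j.1 = s}) := by
    intro s
    have := congrArg (Submodule.map (C s).subtype) (β s).span_eq
    rw [Submodule.map_top, Submodule.range_subtype, Submodule.map_span] at this
    rw [← this, Submodule.span_le]
    rintro _ ⟨_, ⟨i, rfl⟩, rfl⟩
    exact Submodule.subset_span ⟨⟨s, i⟩, rfl, hB ⟨s, i⟩⟩
  refine ⟨_, B, fun j => j.1.1, fun j => j.1.2, fun j => (hCle _ (hBC j)).1,
    fun j => (hCle _ (hBC j)).2, fun n v hv => ?_, fun n v hv => ?_⟩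
  · obtain ⟨b, hb⟩ := hG' v
    refine (iSup₂_le fun s hs => (hCspan s).trans (Submodule.span_mono ?_)) (hle n b ⟨hv, hb⟩)
    rintro _ ⟨j, rfl, rfl⟩
    exact ⟨j, hs.1, rfl⟩
  · obtain ⟨a, ha⟩ := hF' v
    refine (iSup₂_le fun s hs => (hCspan s).trans (Submodule.span_mono ?_)) (hle a n ⟨ha, hv⟩)
    rintro _ ⟨j, rfl, rfl⟩
    exact ⟨j, hs.2, rfl⟩

end Filtrations

/-! ### Torsion-free objects and the filtrations of their generic fibre -/

section Localization

variable {k : Type u} [Field k] {m : ℕ}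

theorem var_pow (σ : Finset (Fin m)) (i : Fin m) (n : ℕ) :
    var k σ i ^ n = monomial k (natMon σ (Pi.single i n)) := by
  rw [var, AddMonoidAlgebra.single_pow, one_pow]
  congr 1
  refine Subtype.ext (funext fun j => ?_)
  by_cases h : j = i
  · subst h
    simp [natMon]
  · simp [natMon, h]

theorem incl_var_pow (i : Fin m) {σ : Finset (Fin m)} (h : σ ⊆ Finset.univ) (n : ℕ) :
    incl k h (var k σ i ^ n) = monomial k (laurentExp (Pi.single i (n : ℤ))) := by
  rw [var_pow, incl_monomial_univ]
  congr 1
  refine Subtype.ext (funext fun j => ?_)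
  by_cases hj : j = i
  · subst hj
    simp [natMon]
  · simp [natMon, hj]

/-- Inverting `t_i` in `R_{[m] ∖ {i}}` gives the Laurent polynomial ring `R_{[m]}`. -/
theorem isLocalization_incl_erase (i : Fin m) :
    letI := (incl k (Finset.subset_univ (Finset.univ.erase i))).toAlgebra
    IsLocalization (Submonoid.powers (var k (Finset.univ.erase i) i))
      (locRing k m Finset.univ) := by
  let _ := (incl k (Finset.subset_univ (Finset.univ.erase i))).toAlgebra
  refine ⟨?_, ?_, ?_⟩
  · rintro ⟨_, n, rfl⟩
    change IsUnit (incl k (Finset.subset_univ (Finset.univ.erase i)) (var k _ i ^ n))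
    rw [incl_var_pow]
    refine IsUnit.of_mul_eq_one (monomial k (laurentExp (-Pi.single i (n : ℤ)))) ?_
    have := monomial_smul_neg (k := k) (Pi.single i (n : ℤ)) (1 : locRing k m Finset.univ)
    simpa only [smul_eq_mul, mul_one] using this
  · suffices h : ∀ r : locRing k m Finset.univ, ∃ (n : ℕ) (x : locRing k m (Finset.univ.erase i)),
        monomial k (laurentExp (Pi.single i (n : ℤ))) * r =
          incl k (Finset.subset_univ (Finset.univ.erase i)) x by
      intro r
      obtain ⟨n, x, hx⟩ := h r
      refine ⟨(x, ⟨var k _ i ^ n, n, rfl⟩), ?_⟩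
      change r * incl k (Finset.subset_univ (Finset.univ.erase i)) (var k _ i ^ n) = incl k _ x
      rw [incl_var_pow, mul_comm, hx]
    intro r
    induction r using AddMonoidAlgebra.induction_linear with
    | zero => exact ⟨0, 0, by rw [mul_zero, map_zero]⟩
    | add r s hr hs =>
      obtain ⟨n, x, hx⟩ := hr
      obtain ⟨n', x', hx'⟩ := hs
      refine ⟨n + n', var k _ i ^ n' * x + var k _ i ^ n * x', ?_⟩
      have : monomial k (laurentExp (Pi.single i ((n + n' : ℕ) : ℤ))) =
          monomial k (laurentExp (Pi.single i (n : ℤ))) *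
            monomial k (laurentExp (Pi.single i (n' : ℤ))) := by
        simp only [← incl_var_pow i (Finset.subset_univ (Finset.univ.erase i)), ← map_mul, pow_add]
      rw [map_add, map_mul, map_mul, incl_var_pow, incl_var_pow, ← hx, ← hx', this]
      ring
    | single g c =>
      refine ⟨((g : Fin m → ℤ) i).natAbs, AddMonoidAlgebra.single
        ⟨(Pi.single i (((g : Fin m → ℤ) i).natAbs : ℤ) : Fin m → ℤ) + (g : Fin m → ℤ),
          fun j hj => ?_⟩ c, ?_⟩
      · have hji : j = i := by
          by_contra h
          exact hj (Finset.mem_erase.2 ⟨h, Finset.mem_univ j⟩)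
        subst hji
        rw [Pi.add_apply, Pi.single_eq_same]
        omega
      · rw [incl_single, AddMonoidAlgebra.single_mul_single, one_mul]
        rfl
  · intro x y h
    exact ⟨1, by rw [incl_injective (k := k) _ h]⟩

variable {i : Fin m} {M : GrMod k m (Finset.univ.erase i)} {U : GrMod k m Finset.univ}
  {f : M →ₛₗ[incl k (Finset.subset_univ (Finset.univ.erase i))] U}

/-- A module without `t_i`-torsion embeds in its localization at `t_i`. -/
theorem injective_of_inducesIso
    (hf : InducesIso (incl k (Finset.subset_univ (Finset.univ.erase i))) f)
    (htf : ∀ x : M, (∃ n : ℕ, var k (Finset.univ.erase i) i ^ n • x = 0) → x = 0) :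
    Function.Injective f := by
  let _ := (incl k (Finset.subset_univ (Finset.univ.erase i))).toAlgebra
  have _ := isLocalization_incl_erase (k := k) i
  let _ : Module (locRing k m (Finset.univ.erase i)) U :=
    Module.compHom U (incl k (Finset.subset_univ (Finset.univ.erase i)))
  have _ : IsScalarTower (locRing k m (Finset.univ.erase i)) (locRing k m Finset.univ) U :=
    ⟨fun a b x => mul_smul (incl k _ a) b x⟩
  let F : M →ₗ[locRing k m (Finset.univ.erase i)] U :=
    { toFun := f, map_add' := f.map_add, map_smul' := f.map_smulₛₗ }
  have hF : IsBaseChange (locRing k m Finset.univ) F := hf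
  have hloc := (isLocalizedModule_iff_isBaseChange
    (Submonoid.powers (var k (Finset.univ.erase i) i)) (locRing k m Finset.univ) F).2 hF
  intro x y hxy
  obtain ⟨⟨_, n, rfl⟩, hc⟩ := hloc.exists_of_eq (x₁ := x) (x₂ := y) hxy
  refine sub_eq_zero.1 (htf _ ⟨n, ?_⟩)
  rw [smul_sub, sub_eq_zero]
  exact hc

/-- Every element of the localization at `t_i` comes from the module after multiplication by a power
of `t_i`. -/
theorem exists_map_eq_of_inducesIso
    (hf : InducesIso (incl k (Finset.subset_univ (Finset.univ.erase i))) f) (y : U) :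
    ∃ (n : ℕ) (x : M), f x = monomial k (laurentExp (Pi.single i (n : ℤ))) • y := by
  let _ := (incl k (Finset.subset_univ (Finset.univ.erase i))).toAlgebra
  have _ := isLocalization_incl_erase (k := k) i
  let _ : Module (locRing k m (Finset.univ.erase i)) U :=
    Module.compHom U (incl k (Finset.subset_univ (Finset.univ.erase i)))
  have _ : IsScalarTower (locRing k m (Finset.univ.erase i)) (locRing k m Finset.univ) U :=
    ⟨fun a b x => mul_smul (incl k _ a) b x⟩
  let F : M →ₗ[locRing k m (Finset.univ.erase i)] U :=
    { toFun := f, map_add' := f.map_add, map_smul' := f.map_smulₛₗ }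
  have hF : IsBaseChange (locRing k m Finset.univ) F := hf
  have hloc := (isLocalizedModule_iff_isBaseChange
    (Submonoid.powers (var k (Finset.univ.erase i) i)) (locRing k m Finset.univ) F).2 hF
  obtain ⟨⟨x, ⟨_, n, rfl⟩⟩, hx⟩ := hloc.surj y
  refine ⟨n, x, ?_⟩
  rw [← incl_var_pow i (Finset.subset_univ (Finset.univ.erase i))]
  exact hx.symm

end Localization

namespace LocMod

variable {k : Type u} [Field k] {m : ℕ}

theorem eq_univ_or_eq_erase_of_notMem {σ : Finset (Fin m)} (hσ : σ ∉ codimTwoSkeleton m) :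
    σ = Finset.univ ∨ ∃ i, σ = Finset.univ.erase i := by
  rw [mem_codimTwoSkeleton] at hσ
  have hc := Finset.card_compl σ
  rw [Fintype.card_fin] at hc
  rcases Nat.lt_or_ge 0 σᶜ.card with h | h
  · obtain ⟨i, hi⟩ := Finset.card_eq_one.1 (show σᶜ.card = 1 by omega)
    exact Or.inr ⟨i, by rw [← compl_compl σ, hi, Finset.compl_singleton]⟩
  · left
    rw [← compl_compl σ, Finset.card_eq_zero.1 (Nat.le_zero.1 h), Finset.compl_empty]

theorem IsTorsionFree.map_injective {M : LocMod k (codimTwoSkeleton m)} (hM : M.IsTorsionFree)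
    (σ : Finset (Fin m)) (hσ : σ ∉ codimTwoSkeleton m) :
    Function.Injective (M.map hσ univ_notMem (Finset.subset_univ σ)) := by
  rcases eq_univ_or_eq_erase_of_notMem hσ with rfl | ⟨i, rfl⟩
  · intro x y h
    rwa [M.map_id, M.map_id] at h
  · exact injective_of_inducesIso (M.inducesIso _ _ _) (hM i)

/-- Along `[m] ∖ {i}` the filtration of the generic fibre depends only on the `i`-th degree. -/
theorem fibreFiltration_erase_mono (M : LocMod k (codimTwoSkeleton m)) (i : Fin m)
    {d e : Fin m → ℤ} (h : d i ≤ e i) :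
    M.fibreFiltration univ_notMem _ (erase_notMem i) d ≤
      M.fibreFiltration univ_notMem _ (erase_notMem i) e := by
  refine fibreFiltration_mono M _ _ fun j hj => ?_
  have hji : j = i := by
    by_contra h
    exact hj (Finset.mem_erase.2 ⟨h, Finset.mem_univ j⟩)
  subst hji
  exact sub_nonneg.2 h

/-- The filtrations of the generic fibre are exhaustive. -/
theorem exists_mem_fibreFiltration_erase (M : LocMod k (codimTwoSkeleton m)) (i : Fin m)
    (v : M.fibre univ_notMem) :
    ∃ n : ℕ, v ∈ M.fibreFiltration univ_notMem _ (erase_notMem i) (Pi.single i (n : ℤ)) := by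
  obtain ⟨n, x, hx⟩ := exists_map_eq_of_inducesIso
    (M.inducesIso (erase_notMem i) univ_notMem (Finset.subset_univ _))
    (v : M.obj Finset.univ univ_notMem)
  refine ⟨n, (M.obj _ _).proj (Pi.single i (n : ℤ)) x, GrMod.proj_mem _ _ _, ?_⟩
  have h := GrMod.map_proj (M.obj _ (erase_notMem i)) (M.obj _ univ_notMem)
    (M.map (erase_notMem i) univ_notMem (Finset.subset_univ _)).toAddMonoidHom
    (M.map_mem _ _ _) (Pi.single i (n : ℤ)) x
  refine h.trans ?_
  change GrMod.proj _ _ (M.map _ _ _ x) = _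
  rw [hx, GrMod.proj_eq_self_iff]
  exact GrMod.monomial_smul_mem _ _ v.2 (add_zero _)

theorem fibreFiltration_erase_eq_bot (M : LocMod k (codimTwoSkeleton m)) (i : Fin m)
    {d : Fin m → ℤ} (h : d i < 0) :
    M.fibreFiltration univ_notMem _ (erase_notMem i) d = ⊥ := by
  rw [eq_bot_iff]
  rintro v ⟨x, hx, hxv⟩
  rw [(M.obj _ _).deg_eq_bot d fun hd =>
    (hd i (Finset.notMem_erase i _)).not_gt h, Submodule.mem_bot] at hx
  rw [hx, map_zero] at hxv
  rw [Submodule.mem_bot]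
  apply Subtype.ext
  apply monomial_smul_injective (k := k) d
  exact hxv.symm.trans (smul_zero _).symm

/-- For two variables, a common adapted basis of the two filtrations of the generic fibre exhibits
a torsion-free object as a direct sum of quadrants. -/
theorem IsTorsionFree.isSumOfQuadrants {M : LocMod k (codimTwoSkeleton 2)}
    (hM : M.IsTorsionFree) : M.IsSumOfQuadrants := by
  let F : Fin 2 → ℕ → Submodule k (M.fibre univ_notMem) := fun i n =>
    M.fibreFiltration univ_notMem _ (erase_notMem i) (Pi.single i (n : ℤ))
  have hF : ∀ i, Monotone (F i) := fun i n n' h =>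
    fibreFiltration_erase_mono M i (by simpa using h)
  obtain ⟨ι, b, p, q, hp, hq, hp', hq'⟩ := exists_basis_adapted (F 0) (F 1) (hF 0) (hF 1)
    (exists_mem_fibreFiltration_erase M 0) (exists_mem_fibreFiltration_erase M 1)
  let a : ι → Fin 2 → ℕ := fun j => ![p j, q j]
  have hmem : ∀ i j, b j ∈ F i (a j i) := by
    intro i j
    fin_cases i
    exacts [hp j, hq j]
  have hspan : ∀ i n, F i n ≤ Submodule.span k (b '' {j | a j i ≤ n}) := by
    intro i n
    fin_cases i
    exacts [hp' n, hq' n]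
  refine isSumOfQuadrants_of_basis M univ_notMem hM.map_injective b a ?_ ?_
  · intro σ hσ j
    rcases eq_univ_or_eq_erase_of_notMem hσ with rfl | ⟨i, rfl⟩
    · exact ⟨_, GrMod.monomial_smul_mem _ _ (b j).2 (add_zero _), M.map_id _ _⟩
    · exact fibreFiltration_erase_mono M i (by simp) (hmem i j)
  · intro σ hσ d
    rcases eq_univ_or_eq_erase_of_notMem hσ with rfl | ⟨i, rfl⟩
    · have : {j | (d - fun i => (a j i : ℤ)) ∈ mon 2 Finset.univ} = Set.univ :=
        Set.eq_univ_of_forall fun j => (laurentExp _).2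
      rw [this, Set.image_univ, b.span_eq]
      exact le_top
    · rcases lt_or_ge (d i) 0 with h | h
      · rw [fibreFiltration_erase_eq_bot M i h]
        exact bot_le
      · obtain ⟨n, hn⟩ := Int.eq_ofNat_of_zero_le h
        refine (fibreFiltration_erase_mono M i (e := Pi.single i (n : ℤ)) (by simp [hn])).trans
          ((hspan i n).trans (Submodule.span_mono (Set.image_mono fun j hj l hl => ?_)))
        have hli : l = i := by
          by_contra h
          exact hl (Finset.mem_erase.2 ⟨h, Finset.mem_univ l⟩)
        subst hli
        rw [Pi.sub_apply, hn, sub_nonneg]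
        exact_mod_cast (show a j l ≤ n from hj)

end LocMod

/-! ### The module `R⟨w, y, z | t_1 w = t_3 y - t_2 z⟩` and its localizations -/

section ThreeGen

attribute [local instance] algebraBase
attribute [local instance] tower_base

open scoped TensorProduct

variable {k : Type u} [Field k] {m : ℕ} (hm : 3 ≤ m)

/-- The first three indices of `[m]`. -/
def ix (j : Fin 3) : Fin m := Fin.castLE hm j

theorem ix_injective : Function.Injective (ix hm) := Fin.castLE_injective hm

/-- The multidegrees of the three generators in the order `w, z, y`, so that the `j`-th one is the
sum of the unit vectors `e_l` with `l ≠ j` among the first three. -/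
def genDeg (j : Fin 3) : Fin m → ℕ :=
  ![Pi.single (ix hm 1) 1 + Pi.single (ix hm 2) 1,
    Pi.single (ix hm 0) 1 + Pi.single (ix hm 2) 1,
    Pi.single (ix hm 0) 1 + Pi.single (ix hm 1) 1] j

theorem genDeg_ix (j l : Fin 3) : genDeg hm j (ix hm l) = if j = l then 0 else 1 := by
  have h : ∀ a b : Fin 3, (ix hm a = ix hm b) = (a = b) := fun a b =>
    propext (ix_injective hm).eq_iff
  fin_cases j <;> fin_cases l <;> simp [genDeg, h]

/-- The relation is homogeneous: the three terms `t_j` times the `j`-th generator have the same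
multidegree. -/
theorem single_add_genDeg (j : Fin 3) :
    Pi.single (ix hm j) 1 + genDeg hm j =
      Pi.single (ix hm 0) 1 + Pi.single (ix hm 1) 1 + Pi.single (ix hm 2) 1 := by
  fin_cases j
  · exact (add_assoc _ _ _).symm
  · exact (add_left_comm _ _ _).trans (add_assoc _ _ _).symm
  · exact add_comm _ _

/-- The presentation of the module by the free module on `w, y, z`. -/
def threeGenMk : (locRing k m ∅ × locRing k m ∅ × locRing k m ∅) →ₗ[locRing k m ∅]
    threeGenModule k hm :=
  Submodule.mkQ (Submodule.span (locRing k m ∅)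
    {((var k ∅ (ix hm 0), -var k ∅ (ix hm 2), var k ∅ (ix hm 1)) :
      locRing k m ∅ × locRing k m ∅ × locRing k m ∅)})

theorem threeGenMk_surjective : Function.Surjective (threeGenMk (k := k) hm) :=
  Submodule.mkQ_surjective _

/-- The generators in the order `w, z, y`. -/
def threeGen (j : Fin 3) : threeGenModule k hm :=
  threeGenMk hm (![(1, 0, 0), (0, 0, 1), (0, 1, 0)] j)

theorem threeGenMk_apply (a b c : locRing k m ∅) :
    threeGenMk hm (a, b, c) =
      a • threeGen (k := k) hm 0 + c • threeGen (k := k) hm 1 + b • threeGen (k := k) hm 2 := by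
  have : ((a, b, c) : locRing k m ∅ × locRing k m ∅ × locRing k m ∅) =
      a • (1, 0, 0) + c • (0, 0, 1) + b • (0, 1, 0) := by simp
  rw [this, map_add, map_add, map_smul, map_smul, map_smul]
  rfl

theorem threeGen_relation :
    var k ∅ (ix hm 0) • threeGen (k := k) hm 0 + var k ∅ (ix hm 1) • threeGen (k := k) hm 1 =
      var k ∅ (ix hm 2) • threeGen (k := k) hm 2 := by
  have h : threeGenMk (k := k) hm (var k ∅ (ix hm 0), -var k ∅ (ix hm 2), var k ∅ (ix hm 1)) = 0 :=
    (Submodule.Quotient.mk_eq_zero _).2 (Submodule.mem_span_singleton_self _)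
  rw [threeGenMk_apply, neg_smul, ← sub_eq_add_neg, sub_eq_zero] at h
  exact h

theorem exists_eq_sum_threeGen (x : threeGenModule k hm) :
    ∃ r : Fin 3 → locRing k m ∅, x = ∑ j, r j • threeGen (k := k) hm j := by
  obtain ⟨⟨a, b, c⟩, rfl⟩ := threeGenMk_surjective hm x
  exact ⟨![a, c, b], by rw [threeGenMk_apply, Fin.sum_univ_three]; rfl⟩

theorem threeGen_mem (j : Fin 3) :
    threeGen (k := k) hm j ∈ (threeGenModule k hm).deg fun i => (genDeg hm j i : ℤ) := by
  have h1 : ∀ a : Fin m → ℕ, (1 : locRing k m ∅) ∈ (GrMod.shift k ∅ a).deg fun i => (a i : ℤ) := by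
    intro a g hg
    have : g = 0 := by
      by_contra h
      refine hg ?_
      rw [AddMonoidAlgebra.one_def, AddMonoidAlgebra.coeff_single, Finsupp.single_apply,
        if_neg (Ne.symm h)]
    rw [this]
    exact zero_add _
  fin_cases j
  exacts [⟨((1, 0, 0) : locRing k m ∅ × locRing k m ∅ × locRing k m ∅),
      ⟨h1 _, Submodule.zero_mem _, Submodule.zero_mem _⟩, rfl⟩,
    ⟨((0, 0, 1) : locRing k m ∅ × locRing k m ∅ × locRing k m ∅),
      ⟨Submodule.zero_mem _, Submodule.zero_mem _, h1 _⟩, rfl⟩,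
    ⟨((0, 1, 0) : locRing k m ∅ × locRing k m ∅ × locRing k m ∅),
      ⟨Submodule.zero_mem _, h1 _, Submodule.zero_mem _⟩, rfl⟩]

/-- The part in multidegree `d` is spanned by monomial multiples of the generators. -/
theorem threeGen_deg_le (d : Fin m → ℤ) (x : threeGenModule k hm)
    (hx : x ∈ (threeGenModule k hm).deg d) :
    x ∈ Submodule.span k {z | ∃ (j : Fin 3) (g : mon m ∅),
      ((g : Fin m → ℤ) + fun i => (genDeg hm j i : ℤ)) = d ∧
        z = monomial k g • threeGen (k := k) hm j} := by
  obtain ⟨⟨a, b, c⟩, ⟨ha, hb, hc⟩, rfl⟩ := hx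
  have key : ∀ (j : Fin 3) (r : locRing k m ∅), r ∈ (GrMod.shift k ∅ (genDeg hm j)).deg d →
      r • threeGen (k := k) hm j ∈ Submodule.span k {z | ∃ (j : Fin 3) (g : mon m ∅),
        ((g : Fin m → ℤ) + fun i => (genDeg hm j i : ℤ)) = d ∧
          z = monomial k g • threeGen (k := k) hm j} := by
    intro j r hr
    rcases mem_deg_shift hr with rfl | ⟨g, e, hg, rfl⟩
    · rw [zero_smul]
      exact Submodule.zero_mem _
    · rw [single_smul_eq]
      exact Submodule.smul_mem _ _ (Submodule.subset_span ⟨j, g, hg, rfl⟩)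
  exact (threeGenMk_apply (k := k) hm a b c).symm ▸
    Submodule.add_mem _ (Submodule.add_mem _ (key 0 a ha) (key 1 c hc)) (key 2 b hb)

/-- The universal property of the presentation. -/
theorem exists_threeGen_lift {N : Type u} [AddCommGroup N] [Module (locRing k m ∅) N]
    (n : Fin 3 → N)
    (hn : var k ∅ (ix hm 0) • n 0 + var k ∅ (ix hm 1) • n 1 = var k ∅ (ix hm 2) • n 2) :
    ∃ f : threeGenModule k hm →ₗ[locRing k m ∅] N, ∀ j, f (threeGen hm j) = n j := by
  let F : (locRing k m ∅ × locRing k m ∅ × locRing k m ∅) →ₗ[locRing k m ∅] N :=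
    (LinearMap.toSpanSingleton _ N (n 0)).coprod
      ((LinearMap.toSpanSingleton _ N (n 2)).coprod (LinearMap.toSpanSingleton _ N (n 1)))
  have hF : ∀ a b c, F (a, b, c) = a • n 0 + (b • n 2 + c • n 1) := fun _ _ _ => rfl
  have hle : Submodule.span (locRing k m ∅)
      {((var k ∅ (ix hm 0), -var k ∅ (ix hm 2), var k ∅ (ix hm 1)) :
        locRing k m ∅ × locRing k m ∅ × locRing k m ∅)} ≤ LinearMap.ker F := by
    rw [Submodule.span_singleton_le_iff_mem, LinearMap.mem_ker, hF, add_left_comm, ← add_assoc,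
      add_assoc, hn, neg_smul, neg_add_cancel]
  let f : threeGenModule k hm →ₗ[locRing k m ∅] N := Submodule.liftQ _ F hle
  have hf : ∀ v, f (threeGenMk hm v) = F v := fun v => Submodule.liftQ_apply _ F v
  refine ⟨f, fun j => ?_⟩
  rw [threeGen, hf]
  fin_cases j
  · change F (1, 0, 0) = n 0
    simp [hF]
  · change F (0, 0, 1) = n 1
    simp [hF]
  · change F (0, 1, 0) = n 2
    simp [hF]

/-- The generators of `R_σ ⊗_R N`. -/
def locGen (k : Type u) [Field k] (σ : Finset (Fin m)) (j : Fin 3) :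
    (threeGenModule k hm).localize σ :=
  ((1 : locRing k m σ) ⊗ₜ[locRing k m ∅] threeGen (k := k) hm j :
    locRing k m σ ⊗[locRing k m ∅] threeGenModule k hm)

theorem smul_locGen (σ : Finset (Fin m)) (j : Fin 3) (r : locRing k m σ) :
    r • locGen hm k σ j = (r ⊗ₜ[locRing k m ∅] threeGen (k := k) hm j :
      locRing k m σ ⊗[locRing k m ∅] threeGenModule k hm) := by
  change r • ((1 : locRing k m σ) ⊗ₜ[locRing k m ∅] threeGen (k := k) hm j :
    locRing k m σ ⊗[locRing k m ∅] threeGenModule k hm) = _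
  rw [TensorProduct.smul_tmul', smul_eq_mul, mul_one]

theorem algebraMap_smul_one (σ : Finset (Fin m)) (r : locRing k m ∅) :
    r • (1 : locRing k m σ) = incl k (Finset.empty_subset σ) r := by
  rw [Algebra.smul_def, mul_one]
  rfl

theorem tmul_smul_threeGen (σ : Finset (Fin m)) (j : Fin 3) (s : locRing k m σ)
    (r : locRing k m ∅) :
    (s ⊗ₜ[locRing k m ∅] (r • threeGen (k := k) hm j) :
      locRing k m σ ⊗[locRing k m ∅] threeGenModule k hm) =
      (s * incl k (Finset.empty_subset σ) r) • locGen hm k σ j := by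
  rw [smul_locGen, ← TensorProduct.smul_tmul, ← algebraMap_smul_one, mul_smul_comm, mul_one]

theorem incl_var {σ τ : Finset (Fin m)} (h : σ ⊆ τ) (i : Fin m) :
    incl k h (var k σ i) = var k τ i :=
  incl_monomial h _

theorem locGen_relation (σ : Finset (Fin m)) :
    var k σ (ix hm 0) • locGen hm k σ 0 + var k σ (ix hm 1) • locGen hm k σ 1 =
      var k σ (ix hm 2) • locGen hm k σ 2 := by
  have h := congrArg (fun x : threeGenModule k hm => ((1 : locRing k m σ) ⊗ₜ[locRing k m ∅] x :
    locRing k m σ ⊗[locRing k m ∅] threeGenModule k hm)) (threeGen_relation (k := k) hm)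
  simp only [TensorProduct.tmul_add, tmul_smul_threeGen, one_mul, incl_var] at h
  exact h

theorem exists_eq_sum_locGen (σ : Finset (Fin m)) (x : (threeGenModule k hm).localize σ) :
    ∃ r : Fin 3 → locRing k m σ, x = ∑ j, r j • locGen hm k σ j := by
  change (locRing k m σ ⊗[locRing k m ∅] threeGenModule k hm) at x
  induction x using TensorProduct.induction_on with
  | zero => exact ⟨0, by simp only [Pi.zero_apply, zero_smul, Finset.sum_const_zero]; rfl⟩
  | add x y hx hy =>
    obtain ⟨r, hr⟩ := hx
    obtain ⟨s, hs⟩ := hy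
    refine ⟨r + s, ?_⟩
    simp only [Pi.add_apply, add_smul, Finset.sum_add_distrib, ← hr, ← hs]
    rfl
  | tmul s x =>
    obtain ⟨r, rfl⟩ := exists_eq_sum_threeGen hm x
    refine ⟨fun j => s * incl k (Finset.empty_subset σ) (r j), ?_⟩
    rw [TensorProduct.tmul_sum]
    exact Finset.sum_congr rfl fun j _ => tmul_smul_threeGen hm σ j s (r j)

theorem locGen_mem (σ : Finset (Fin m)) (j : Fin 3) :
    locGen hm k σ j ∈ ((threeGenModule k hm).localize σ).deg fun i => (genDeg hm j i : ℤ) := by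
  have h : ((1 : locRing k m σ) ⊗ₜ[locRing k m ∅] threeGen (k := k) hm j :
      locRing k m σ ⊗[locRing k m ∅] threeGenModule k hm) ∈
      tensorDeg σ (threeGenModule k hm) fun i => (genDeg hm j i : ℤ) :=
    Submodule.subset_span ⟨0, _, _, threeGen_mem hm j, zero_add _, rfl⟩
  exact h

/-- The part of the localization in multidegree `d` is spanned by monomial multiples of the
generators. -/
theorem locGen_deg_le (σ : Finset (Fin m)) (d : Fin m → ℤ)
    (x : (threeGenModule k hm).localize σ) (hx : x ∈ ((threeGenModule k hm).localize σ).deg d) :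
    x ∈ Submodule.span k {z | ∃ (j : Fin 3) (g : mon m σ),
      ((g : Fin m → ℤ) + fun i => (genDeg hm j i : ℤ)) = d ∧
        z = monomial k g • locGen hm k σ j} := by
  have key : ∀ (g : mon m σ) (e : Fin m → ℤ) (y : threeGenModule k hm),
      y ∈ (threeGenModule k hm).deg e → (g : Fin m → ℤ) + e = d →
      ((monomial k g ⊗ₜ[locRing k m ∅] y :
        locRing k m σ ⊗[locRing k m ∅] threeGenModule k hm) :
          (threeGenModule k hm).localize σ) ∈
        Submodule.span k {z : (threeGenModule k hm).localize σ | ∃ (j : Fin 3) (g : mon m σ),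
          ((g : Fin m → ℤ) + fun i => (genDeg hm j i : ℤ)) = d ∧
            z = monomial k g • locGen hm k σ j} := by
    rintro g e y hy rfl
    have h := threeGen_deg_le hm e y hy
    clear hy
    induction h using Submodule.span_induction with
    | mem y hy' =>
      obtain ⟨j, h, rfl, rfl⟩ := hy'
      refine Submodule.subset_span
        ⟨j, g + AddSubmonoid.inclusion (mon_mono (Finset.empty_subset σ)) h, ?_, ?_⟩
      · rw [AddSubmonoid.coe_add, add_assoc]
        rfl
      · rw [← monomial_mul, ← incl_monomial]
        exact tmul_smul_threeGen hm σ j _ _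
    | zero =>
      rw [TensorProduct.tmul_zero]
      exact Submodule.zero_mem _
    | add y z _ _ hy hz =>
      rw [TensorProduct.tmul_add]
      exact Submodule.add_mem _ hy hz
    | smul c y _ hy =>
      have h := Submodule.smul_mem _ c hy
      refine (congrArg (· ∈ _) ?_).mp h
      change c • (monomial k g ⊗ₜ[locRing k m ∅] y :
        locRing k m σ ⊗[locRing k m ∅] threeGenModule k hm) = monomial k g ⊗ₜ (c • y)
      rw [← algebraMap_smul (locRing k m ∅) c y, ← TensorProduct.smul_tmul,
        TensorProduct.smul_tmul', algebraMap_smul]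
  have hle : ((threeGenModule k hm).localize σ).deg d ≤
      Submodule.span k {z : (threeGenModule k hm).localize σ | ∃ (j : Fin 3) (g : mon m σ),
        ((g : Fin m → ℤ) + fun i => (genDeg hm j i : ℤ)) = d ∧
          z = monomial k g • locGen hm k σ j} := by
    refine Submodule.span_le.2 ?_
    rintro _ ⟨g, e, y, hy, h, rfl⟩
    exact key g e y hy h
  exact hle hx

theorem map_locGen {σ τ : Finset (Fin m)} (h : σ ⊆ τ) (j : Fin 3) :
    tensorMap (threeGenModule k hm) h (locGen hm k σ j) = locGen hm k τ j := by
  refine (tensorMap_tmul (threeGenModule k hm) h 1 (threeGen hm j)).trans ?_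
  rw [map_one]
  rfl

/-- The degree of the relation, the sum of the first three unit vectors. -/
def relDeg : Fin m → ℤ := fun i =>
  ((Pi.single (ix hm 0) 1 + Pi.single (ix hm 1) 1 + Pi.single (ix hm 2) 1 : Fin m → ℕ) i : ℤ)

theorem var_mul_monomial_genDeg (j : Fin 3) :
    var k Finset.univ (ix hm j) * monomial k (laurentExp fun i => (genDeg hm j i : ℤ)) =
      monomial k (laurentExp (relDeg hm)) := by
  rw [var, monomial_mul]
  congr 1
  refine Subtype.ext (funext fun i => ?_)
  have := congrFun (single_add_genDeg hm j) i
  change ((Pi.single (ix hm j) 1 : Fin m → ℕ) i : ℤ) + (genDeg hm j i : ℤ) = relDeg hm i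
  rw [relDeg, ← this, Pi.add_apply]
  push_cast
  rfl

/-- The images of `w, z, y` in the free module of rank two: in multidegree `0` they are the three
vectors `(1, -1)`, `(0, 1)`, `(1, 0)`. -/
def frameImage (k : Type u) [Field k] (j : Fin 3) :
    locRing k m Finset.univ × locRing k m Finset.univ :=
  monomial k (laurentExp fun i => (genDeg hm j i : ℤ)) • ![(1, -1), (0, 1), (1, 0)] j

theorem exists_frame : ∃ F : (threeGenModule k hm).localize Finset.univ →ₗ[locRing k m Finset.univ]
    (locRing k m Finset.univ × locRing k m Finset.univ),
    ∀ j, F (locGen hm k Finset.univ j) = frameImage hm k j := by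
  have hvar : ∀ (i : Fin m) (x : locRing k m Finset.univ × locRing k m Finset.univ),
      var k ∅ i • x = var k Finset.univ i • x := fun i x => by
    rw [← incl_var (Finset.empty_subset Finset.univ) i]
    exact (algebraMap_smul (locRing k m Finset.univ) (var k ∅ i) x).symm
  have hrel : var k ∅ (ix hm 0) • frameImage hm k 0 + var k ∅ (ix hm 1) • frameImage hm k 1 =
      var k ∅ (ix hm 2) • frameImage hm k 2 := by
    simp only [hvar, frameImage, smul_smul, var_mul_monomial_genDeg]
    rw [← smul_add]
    congr 1
    simp
  obtain ⟨f, hf⟩ := exists_threeGen_lift hm (frameImage hm k) hrel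
  refine ⟨f.liftBaseChange (locRing k m Finset.univ), fun j => ?_⟩
  refine (LinearMap.liftBaseChange_tmul (locRing k m Finset.univ) f 1 (threeGen hm j)).trans ?_
  rw [one_smul, hf]

/-- A choice of linear map from `M_{[m]}` to the free module of rank two with the values
`frameImage` on the generators. -/
def frame (k : Type u) [Field k] :
    (threeGenModule k hm).localize Finset.univ →ₗ[locRing k m Finset.univ]
      (locRing k m Finset.univ × locRing k m Finset.univ) :=
  (exists_frame hm).choose

theorem frame_locGen (j : Fin 3) :
    frame hm k (locGen hm k Finset.univ j) = frameImage hm k j :=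
  (exists_frame hm).choose_spec j

theorem isUnit_var {σ : Finset (Fin m)} {i : Fin m} (hi : i ∈ σ) : IsUnit (var k σ i) := by
  refine IsUnit.of_mul_eq_one (monomial k (⟨-Pi.single i 1, fun j hj => ?_⟩ : mon m σ)) ?_
  · have : j ≠ i := fun h => hj (h ▸ hi)
    simp [this]
  · rw [var, monomial_mul, ← monomial_zero]
    congr 1
    refine Subtype.ext (funext fun j => ?_)
    by_cases hj : j = i
    · subst hj
      simp [natMon]
    · simp [natMon, hj]

theorem var_mul_injective (σ : Finset (Fin m)) (i : Fin m) :
    Function.Injective fun r : locRing k m σ => var k σ i * r := by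
  intro r s h
  apply incl_injective (k := k) (Finset.subset_univ σ)
  have := congrArg (incl k (Finset.subset_univ σ)) h
  simp only [map_mul, incl_var] at this
  exact (isUnit_var (Finset.mem_univ i)).mul_left_cancel this

/-- The localizations of the module at all but at most one of the variables embed into the free
module of rank two: an element of the kernel of the frame is killed by `t_1` and by `t_2`, at least
one of which is invertible. -/
theorem tensorMap_univ_injective {σ : Finset (Fin m)} (hσ : ix hm 0 ∈ σ ∨ ix hm 1 ∈ σ)
    (x : (threeGenModule k hm).localize σ)
    (hx : frame hm k (tensorMap (threeGenModule k hm) (Finset.subset_univ σ) x) = 0) : x = 0 := by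
  obtain ⟨r, rfl⟩ := exists_eq_sum_locGen hm σ x
  have hx' : ∑ j, incl k (Finset.subset_univ σ) (r j) • frameImage hm k j = 0 := by
    rw [← hx]
    refine Eq.symm ((congrArg (frame hm k) (map_sum
      (tensorMap (threeGenModule k hm) (Finset.subset_univ σ)) _ _)).trans ?_)
    refine (map_sum (frame hm k) _ _).trans (Finset.sum_congr rfl fun j _ => ?_)
    refine (congrArg (frame hm k) (map_smulₛₗ
      (tensorMap (threeGenModule k hm) (Finset.subset_univ σ)) (r j) (locGen hm k σ j))).trans ?_
    refine (map_smul (frame hm k) _ _).trans ?_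
    rw [← frame_locGen]
    exact congrArg (fun z => incl k (Finset.subset_univ σ) (r j) • frame hm k z)
      (map_locGen hm (Finset.subset_univ σ) j)
  have h1 := congrArg Prod.fst hx'
  have h2 := congrArg Prod.snd hx'
  simp only [Fin.sum_univ_three, frameImage, Prod.fst_add, Prod.snd_add, Prod.smul_fst,
    Prod.smul_snd, smul_eq_mul, Matrix.cons_val_zero, Matrix.cons_val_one, Matrix.cons_val,
    mul_one, mul_zero, add_zero, mul_neg, Prod.fst_zero, Prod.snd_zero] at h1 h2
  have e0 := var_mul_monomial_genDeg (k := k) hm 0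
  have e1 := var_mul_monomial_genDeg (k := k) hm 1
  have e2 := var_mul_monomial_genDeg (k := k) hm 2
  -- the two coordinates of the relation between the images, cleared of denominators
  have h02 : var k σ (ix hm 2) * r 0 + var k σ (ix hm 0) * r 2 = 0 := by
    apply incl_injective (k := k) (Finset.subset_univ σ)
    apply monomial_smul_injective (k := k) (relDeg hm)
    simp only [map_add, map_mul, incl_var, map_zero, smul_eq_mul, mul_zero]
    linear_combination (var k Finset.univ (ix hm 0) * var k Finset.univ (ix hm 2)) * h1
      - incl k (Finset.subset_univ σ) (r 0) * var k Finset.univ (ix hm 2) * e0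
      - incl k (Finset.subset_univ σ) (r 2) * var k Finset.univ (ix hm 0) * e2
  have h01 : var k σ (ix hm 0) * r 1 = var k σ (ix hm 1) * r 0 := by
    apply incl_injective (k := k) (Finset.subset_univ σ)
    apply monomial_smul_injective (k := k) (relDeg hm)
    simp only [map_mul, incl_var, smul_eq_mul]
    linear_combination (var k Finset.univ (ix hm 0) * var k Finset.univ (ix hm 1)) * h2
      - incl k (Finset.subset_univ σ) (r 1) * var k Finset.univ (ix hm 0) * e1
      + incl k (Finset.subset_univ σ) (r 0) * var k Finset.univ (ix hm 1) * e0
  have h12 : var k σ (ix hm 2) * r 1 + var k σ (ix hm 1) * r 2 = 0 := by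
    apply var_mul_injective σ (ix hm 0)
    simp only [mul_zero]
    linear_combination var k σ (ix hm 1) * h02 + var k σ (ix hm 2) * h01
  -- both `t_1 x` and `t_2 x` are multiples of the relation
  have key : ∀ i : Fin 3, var k σ (ix hm i) * r 1 = var k σ (ix hm 1) * r i →
      var k σ (ix hm i) * r 0 = var k σ (ix hm 0) * r i →
      var k σ (ix hm 2) * r i + var k σ (ix hm i) * r 2 = 0 →
      var k σ (ix hm i) • ∑ j, r j • locGen hm k σ j = 0 := by
    intro i h1 h0 h2
    have hrel := sub_eq_zero.2 (locGen_relation (k := k) hm σ)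
    have := congrArg (r i • ·) hrel
    simp only [smul_zero] at this
    rw [← this, Fin.sum_univ_three]
    simp only [smul_add, smul_sub, smul_smul, h1, h0, eq_neg_of_add_eq_zero_right h2, neg_smul,
      mul_comm (r i)]
    abel
  rcases hσ with h | h
  · exact (isUnit_var h).smul_eq_zero.1 (key 0 h01 rfl h02)
  · exact (isUnit_var h).smul_eq_zero.1 (key 1 rfl h01.symm h12)

end ThreeGen

/-! ### Indecomposability -/

theorem indecomposable_of_idempotents_trivial {C : Type*} [Category C] [Preadditive C]
    [HasBinaryBiproducts C] {X : C} (hX : ¬IsZero X)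
    (h : ∀ e : X ⟶ X, e ≫ e = e → e = 0 ∨ e = 𝟙 X) : Indecomposable X := by
  refine ⟨hX, fun Y Z i => ?_⟩
  rcases h (i.hom ≫ biprod.fst ≫ biprod.inl ≫ i.inv) (by simp) with h0 | h1
  · left
    rw [IsZero.iff_id_eq_zero]
    have := congrArg (fun e => biprod.inl ≫ i.inv ≫ e ≫ i.hom ≫ biprod.fst) h0
    simpa using this
  · right
    rw [IsZero.iff_id_eq_zero]
    have := congrArg (fun e => biprod.inr ≫ i.inv ≫ e ≫ i.hom ≫ biprod.snd) h1
    simpa using this.symm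

namespace LocMod

variable {k : Type u} [Field k] {m : ℕ} (hm : 3 ≤ m)

/-- The localization of the three-generator module in the category attached to `K_m`. -/
abbrev threeGenLoc (k : Type u) [Field k] {m : ℕ} (hm : 3 ≤ m) : LocMod k (codimTwoSkeleton m) :=
  localization (codimTwoSkeleton m) (threeGenModule k hm)

theorem ix_mem_of_notMem {σ : Finset (Fin m)} (hσ : σ ∉ codimTwoSkeleton m) :
    ix hm 0 ∈ σ ∨ ix hm 1 ∈ σ := by
  rcases eq_univ_or_eq_erase_of_notMem hσ with rfl | ⟨i, rfl⟩
  · exact Or.inl (Finset.mem_univ _)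
  · by_cases h : ix hm 0 = i
    · refine Or.inr (Finset.mem_erase.2 ⟨fun h' => ?_, Finset.mem_univ _⟩)
      exact absurd (ix_injective hm (h.trans h'.symm)) (by decide)
    · exact Or.inl (Finset.mem_erase.2 ⟨h, Finset.mem_univ _⟩)

theorem threeGenLoc_map_injective {σ : Finset (Fin m)} (hσ : σ ∉ codimTwoSkeleton m) :
    Function.Injective
      ((threeGenLoc k hm).map hσ univ_notMem (Finset.subset_univ σ)) := by
  rw [injective_iff_map_eq_zero]
  intro x hx
  exact tensorMap_univ_injective hm (ix_mem_of_notMem hm hσ) x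
    ((congrArg (frame hm k) hx).trans (map_zero _))

theorem frame_injective : Function.Injective (frame (k := k) hm) := by
  rw [injective_iff_map_eq_zero]
  intro x hx
  refine tensorMap_univ_injective hm (Or.inl (Finset.mem_univ _)) x ?_
  rw [← hx]
  exact congrArg (frame hm k) (tensorMap_refl _ _ x)

theorem threeGenLoc_isTorsionFree : (threeGenLoc k hm).IsTorsionFree := by
  rintro i x ⟨n, hn⟩
  apply threeGenLoc_map_injective hm (erase_notMem i)
  have h := congrArg ((threeGenLoc k hm).map (erase_notMem i) univ_notMem
    (Finset.subset_univ _)) hn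
  rw [map_smulₛₗ, map_zero, map_pow, incl_var] at h
  rw [((isUnit_var (Finset.mem_univ i)).pow n).smul_eq_zero.1 h, map_zero]

/-- The translates `t^{-|y|} y` and `t^{-|z|} z` of two generators to multidegree `0`. -/
def zeroGen (k : Type u) [Field k] (j : Fin 2) : (threeGenModule k hm).localize Finset.univ :=
  monomial k (laurentExp (-fun i => (genDeg hm (![2, 1] j) i : ℤ))) •
    locGen hm k Finset.univ (![2, 1] j)

theorem frame_zeroGen (j : Fin 2) : frame hm k (zeroGen hm k j) = ![(1, 0), (0, 1)] j := by
  have h := fun l => monomial_smul_neg (k := k) (-fun i => (genDeg hm l i : ℤ))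
    ((![(1, -1), (0, 1), (1, 0)] : Fin 3 → locRing k m Finset.univ × locRing k m Finset.univ) l)
  simp only [neg_neg] at h
  rw [zeroGen, map_smul, frame_locGen, frameImage, h]
  fin_cases j <;> rfl

theorem linearIndependent_zeroGen :
    LinearIndependent (locRing k m Finset.univ) (zeroGen hm k) := by
  rw [Fintype.linearIndependent_iff]
  intro r hr
  have h := congrArg (frame hm k) hr
  rw [map_sum, map_zero, Fin.sum_univ_two, map_smul, map_smul, frame_zeroGen, frame_zeroGen] at h
  have h1 := congrArg Prod.fst h
  have h2 := congrArg Prod.snd h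
  simp at h1 h2
  intro j
  fin_cases j
  exacts [h1, h2]

theorem deg_zero_eq_span :
    ((threeGenModule k hm).localize Finset.univ).deg 0 =
      Submodule.span k (Set.range (zeroGen hm k)) := by
  apply le_antisymm
  · intro x hx
    refine (Submodule.span_le (p := Submodule.span k (Set.range (zeroGen hm k)))).2 ?_
      (locGen_deg_le hm _ 0 x hx)
    rintro _ ⟨j, g, hg, rfl⟩
    obtain rfl : g = laurentExp (-fun i => (genDeg hm j i : ℤ)) :=
      Subtype.ext (eq_neg_of_add_eq_zero_left hg)
    have h2 : zeroGen hm k 0 ∈ Submodule.span k (Set.range (zeroGen hm k)) :=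
      Submodule.subset_span ⟨0, rfl⟩
    have h1 : zeroGen hm k 1 ∈ Submodule.span k (Set.range (zeroGen hm k)) :=
      Submodule.subset_span ⟨1, rfl⟩
    fin_cases j
    · have : monomial k (laurentExp (-fun i => (genDeg hm 0 i : ℤ))) •
          locGen hm k Finset.univ 0 = zeroGen hm k 0 - zeroGen hm k 1 := by
        apply frame_injective hm
        have h := monomial_smul_neg (k := k) (-fun i => (genDeg hm 0 i : ℤ))
          ((1, -1) : locRing k m Finset.univ × locRing k m Finset.univ)
        rw [neg_neg] at h
        rw [map_smul, map_sub, frame_locGen, frame_zeroGen, frame_zeroGen]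
        refine h.trans ?_
        simp
      exact this ▸ Submodule.sub_mem _ h2 h1
    · exact h1
    · exact h2
  · rw [Submodule.span_le]
    rintro _ ⟨j, rfl⟩
    exact GrMod.monomial_smul_mem _ _ (locGen_mem hm _ _) (neg_add_cancel _)

theorem rank_threeGenLoc : (threeGenLoc k hm).rank univ_notMem = 2 := by
  change Module.finrank k (((threeGenModule k hm).localize Finset.univ).deg 0) = 2
  have hli : LinearIndependent k (zeroGen hm k) :=
    (linearIndependent_zeroGen hm).restrict_scalars fun c d h => by
      simpa [AddMonoidAlgebra.one_def] using h
  rw [deg_zero_eq_span, finrank_span_eq_card hli, Fintype.card_fin]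

/-- The component of an endomorphism at a face, as an endomorphism of the localized module. -/
def appAt (f : threeGenLoc k hm ⟶ threeGenLoc k hm) (σ : Finset (Fin m))
    (hσ : σ ∉ codimTwoSkeleton m) :
    (threeGenModule k hm).localize σ →ₗ[locRing k m σ] (threeGenModule k hm).localize σ :=
  Hom.app f σ hσ

/-- An endomorphism scales each generator: over `[m] ∖ {i}` the part of the module in the
multidegree of the generator whose `i`-th degree vanishes is one-dimensional. -/
theorem exists_appAt_locGen (f : threeGenLoc k hm ⟶ threeGenLoc k hm) (j : Fin 3) :
    ∃ c : k, appAt hm f Finset.univ univ_notMem (locGen hm k Finset.univ j) =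
      c • locGen hm k Finset.univ j := by
  have hy : appAt hm f _ (erase_notMem (ix hm j)) (locGen hm k _ j) ∈
      ((threeGenModule k hm).localize (Finset.univ.erase (ix hm j))).deg
        fun i => (genDeg hm j i : ℤ) :=
    Hom.app_mem f _ (erase_notMem (ix hm j)) _ _ (locGen_mem (k := k) hm _ j)
  have hspan : appAt hm f _ (erase_notMem (ix hm j)) (locGen hm k _ j) ∈
      Submodule.span k {locGen hm k (Finset.univ.erase (ix hm j)) j} := by
    refine (Submodule.span_le (p := Submodule.span k
      {locGen hm k (Finset.univ.erase (ix hm j)) j})).2 ?_ (locGen_deg_le hm _ _ _ hy)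
    rintro _ ⟨l, g, hg, rfl⟩
    have hlj : l = j := by
      by_contra hne
      have h1 := congrFun hg (ix hm j)
      have h2 := g.2 (ix hm j) (Finset.notMem_erase _ _)
      simp only [Pi.add_apply, genDeg_ix, if_neg hne, if_true] at h1
      push_cast at h1
      omega
    subst hlj
    obtain rfl : g = 0 := Subtype.ext (add_eq_right.1 hg)
    rw [monomial_zero, one_smul]
    exact Submodule.mem_span_singleton_self _
  obtain ⟨c, hc⟩ := Submodule.mem_span_singleton.1 hspan
  refine ⟨c, ?_⟩
  have hmap : (threeGenLoc k hm).map (erase_notMem (ix hm j)) univ_notMem (Finset.subset_univ _)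
      (locGen hm k _ j) = locGen hm k Finset.univ j := map_locGen hm _ j
  have hnat := Hom.naturality f (erase_notMem (ix hm j)) univ_notMem (Finset.subset_univ _)
    (locGen hm k _ j)
  rw [hmap] at hnat
  refine hnat.trans ((congrArg ((threeGenLoc k hm).map (erase_notMem (ix hm j)) univ_notMem
    (Finset.subset_univ _)) hc.symm).trans ?_)
  exact (GrMod.map_smul_base _ _ _ _ c _).trans (congrArg (c • ·) hmap)

/-- Every endomorphism is a scalar: it scales the three generators, and the relation between them
forces the three factors to agree. -/
theorem exists_appAt_eq_smul (f : threeGenLoc k hm ⟶ threeGenLoc k hm) :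
    ∃ c : k, ∀ σ hσ x, appAt hm f σ hσ x = c • x := by
  choose c hc using exists_appAt_locGen hm f
  have hT : monomial k (laurentExp (relDeg hm)) ≠ 0 := by
    simp [monomial]
  have hrel : c 0 • var k Finset.univ (ix hm 0) • frameImage hm k 0 +
      c 1 • var k Finset.univ (ix hm 1) • frameImage hm k 1 =
        c 2 • var k Finset.univ (ix hm 2) • frameImage hm k 2 := by
    have h := congrArg (fun x => frame hm k (appAt hm f Finset.univ univ_notMem x))
      (locGen_relation (k := k) hm Finset.univ)
    have hk : ∀ (c : k) x, frame hm k (c • x) = c • frame hm k x :=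
      LinearMap.map_smul_of_tower (frame hm k)
    simpa only [map_add, map_smul, hc, hk, frame_locGen,
      smul_comm (var k Finset.univ _) (c _)] using h
  simp only [frameImage, smul_smul, var_mul_monomial_genDeg] at hrel
  have h1 := congrArg Prod.fst hrel
  have h2 := congrArg Prod.snd hrel
  simp only [Prod.fst_add, Prod.snd_add, Prod.smul_fst, Prod.smul_snd, smul_eq_mul,
    Matrix.cons_val_zero, Matrix.cons_val_one, Matrix.cons_val, mul_one, mul_zero, add_zero,
    mul_neg, smul_zero, smul_neg] at h1 h2
  have h02 : c 0 = c 2 := smul_left_injective k hT h1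
  have h01 : c 0 = c 1 := smul_left_injective k hT (neg_add_eq_zero.1 h2)
  have hcj : ∀ j, c j = c 0 := by
    intro j
    fin_cases j
    exacts [rfl, h01.symm, h02.symm]
  have huniv : ∀ x, appAt hm f Finset.univ univ_notMem x = c 0 • x := by
    intro x
    obtain ⟨r, rfl⟩ := exists_eq_sum_locGen (k := k) hm Finset.univ x
    rw [map_sum, Finset.smul_sum]
    refine Finset.sum_congr rfl fun j _ => ?_
    rw [map_smul, hc, hcj]
    exact smul_comm _ _ _
  refine ⟨c 0, fun σ hσ x => ?_⟩
  apply threeGenLoc_map_injective hm hσ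
  exact (Hom.naturality f hσ univ_notMem (Finset.subset_univ σ) x).symm.trans
    ((huniv _).trans (GrMod.map_smul_base _ _ (Finset.subset_univ σ)
      ((threeGenLoc k hm).map hσ univ_notMem (Finset.subset_univ σ)) (c 0) x).symm)

theorem zeroGen_ne_zero (j : Fin 2) : zeroGen hm k j ≠ 0 :=
  (linearIndependent_zeroGen hm).ne_zero j

theorem eq_zero_or_eq_id_of_idempotent (e : threeGenLoc k hm ⟶ threeGenLoc k hm)
    (he : e ≫ e = e) : e = 0 ∨ e = 𝟙 _ := by
  obtain ⟨c, hc⟩ := exists_appAt_eq_smul hm e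
  have h : appAt hm e Finset.univ univ_notMem
      (appAt hm e Finset.univ univ_notMem (zeroGen hm k 0)) =
      appAt hm e Finset.univ univ_notMem (zeroGen hm k 0) :=
    congrArg (fun g => Hom.app g Finset.univ univ_notMem (zeroGen hm k 0)) he
  rw [hc, hc, smul_smul] at h
  have hcc : c * c = c := smul_left_injective k (zeroGen_ne_zero hm 0) h
  rcases IsIdempotentElem.iff_eq_zero_or_one.1 hcc with rfl | rfl
  · left
    ext σ hσ x
    exact (hc σ hσ x).trans (zero_smul k _)
  · right
    ext σ hσ x
    exact (hc σ hσ x).trans (one_smul k _)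

theorem not_isZero_threeGenLoc : ¬IsZero (threeGenLoc k hm) := by
  rw [IsZero.iff_id_eq_zero]
  intro h
  exact zeroGen_ne_zero (k := k) hm 0
    (congrArg (fun g => Hom.app g Finset.univ univ_notMem (zeroGen hm k 0)) h)

theorem indecomposable_threeGenLoc : Indecomposable (threeGenLoc k hm) :=
  indecomposable_of_idempotents_trivial (not_isZero_threeGenLoc hm)
    (eq_zero_or_eq_id_of_idempotent hm)

/-- The object is not a retract of a quadrant: a module of rank two does not embed in one of rank
one. -/
theorem not_retract_quadrant (a : Fin m → ℕ)
    (s : threeGenLoc k hm ⟶ quadrant k (codimTwoSkeleton m) a)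
    (p : quadrant k (codimTwoSkeleton m) a ⟶ threeGenLoc k hm) : s ≫ p ≠ 𝟙 _ := by
  intro hsp
  have hinj : ∀ x, Hom.app s Finset.univ univ_notMem x = 0 → x = 0 := by
    intro x hx
    have h := congrArg (fun g => Hom.app g Finset.univ univ_notMem x) hsp
    simp only [comp_app, LinearMap.comp_apply, hx, map_zero] at h
    exact h.symm
  -- with `S` injective and valued in a commutative ring, `S u • v = S v • u` contradicts
  -- independence
  let S : (threeGenModule k hm).localize Finset.univ →ₗ[locRing k m Finset.univ]
    locRing k m Finset.univ := Hom.app s Finset.univ univ_notMem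
  have hS : ∑ j, ![S (zeroGen hm k 1), -S (zeroGen hm k 0)] j • zeroGen hm k j = 0 := by
    apply hinj
    change S _ = 0
    rw [Fin.sum_univ_two, map_add, map_smul, map_smul]
    simp only [Matrix.cons_val_zero, Matrix.cons_val_one, smul_eq_mul]
    ring
  have h := Fintype.linearIndependent_iff.1 (linearIndependent_zeroGen hm) _ hS 0
  exact zeroGen_ne_zero hm 1 (hinj _ h)

theorem not_isSumOfQuadrants_threeGenLoc : ¬(threeGenLoc k hm).IsSumOfQuadrants := by
  rintro ⟨n, a, ⟨i⟩⟩
  -- each summand gives an idempotent, which is zero since it factors through a quadrant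
  have h0 : ∀ j, i.hom ≫ biproduct.π (fun j => quadrant k (codimTwoSkeleton m) (a j)) j ≫
      biproduct.ι (fun j => quadrant k (codimTwoSkeleton m) (a j)) j ≫ i.inv = 0 := by
    intro j
    refine (eq_zero_or_eq_id_of_idempotent hm _ ?_).resolve_right fun h => ?_
    · simp
    · exact not_retract_quadrant hm (a j) (i.hom ≫ biproduct.π _ j)
        (biproduct.ι (fun j => quadrant k (codimTwoSkeleton m) (a j)) j ≫ i.inv)
        (by simpa using h)
  refine not_isZero_threeGenLoc (k := k) hm ((IsZero.iff_id_eq_zero _).2 ?_)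
  rw [← i.hom_inv_id, ← Category.id_comp i.inv, ← biproduct.total, Preadditive.sum_comp,
    Preadditive.comp_sum]
  exact Finset.sum_eq_zero fun j _ => by simpa using h0 j

end LocMod

end

end PersLoc

theorem mainTheorem6 (k : Type u) [Field k] :
    (∀ (m : ℕ) (hm : 3 ≤ m),
      let M : PersLoc.LocMod k (PersLoc.codimTwoSkeleton m) :=
        PersLoc.LocMod.localization (PersLoc.codimTwoSkeleton m) (PersLoc.threeGenModule k hm)
      M.IsTorsionFree ∧ M.rank PersLoc.univ_notMem = 2 ∧ Indecomposable M ∧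
        ¬ M.IsSumOfQuadrants) ∧
    (∀ M : PersLoc.LocMod k (PersLoc.codimTwoSkeleton 2), M.IsTorsionFree → M.IsSumOfQuadrants) :=
  ⟨fun _ hm => ⟨PersLoc.LocMod.threeGenLoc_isTorsionFree hm, PersLoc.LocMod.rank_threeGenLoc hm,
    PersLoc.LocMod.indecomposable_threeGenLoc hm,
    PersLoc.LocMod.not_isSumOfQuadrants_threeGenLoc hm⟩,
    fun _ hM => hM.isSumOfQuadrants⟩
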